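/- Let $M$ be a smooth $n$-dimensional manifold and let $\mathbf G$ be a spray on $M$, that is, a smooth vector field on a conical region $\mathcal C$ of $TM\setminus\{0\}$ (an open set with $\lambda y\in\mathcal C$ whenever $y\in\mathcal C$ and $\lambda>0$) that in the local coordinates $(x^i,y^i)$ of $TM$ induced by any chart of $M$ has the form $$\mathbf G=y^i\frac{\partial}{\partial x^i}-2G^i\frac{\partial}{\partial y^i},$$ where the functions $G^i=G^i(x,y)$ are positively homogeneous of degree two in $y$. Write $\partial_k=\partial/\partial x^k$, $\dot\partial_k=\partial/\partial y^k$. Suppose that $\mathbf G$ is R-flat, i.e. that its Riemann curvature $$R^i{}_k=2\partial_kG^i-y^j\,\partial_j\dot\partial_kG^i+2G^j\,\dot\partial_j\dot\partial_kG^i-(\dot\partial_jG^i)(\dot\partial_kG^j)$$ vanishes on $\mathcal C$. Then nontrivial local Funk functions of $\mathbf G$ exist near every point: for every $x_0\in M$ and every $y_0\in\mathcal C\cap T_{x_0}M$ there are an open neighbourhood $U$ of $x_0$ in $M$ and a smooth function $P$ on the part $\mathcal C\cap TU$ of $\mathcal C$ lying over $U$ such that $P(x_0,y_0)\neq0$ and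 $P$ is a Funk function of $\mathbf G$ there, i.e. $P(x,\lambda y)=\lambda P(x,y)$ for $\lambda>0$ and, in all local coordinates, $$P_{;k}=P\,P_{.k}\quad(k=1,\dots,n),\qquad P_{;k}:=\partial_kP-(\dot\partial_kG^r)\,\dot\partial_rP,\quad P_{.k}:=\dot\partial_kP .$$ -/

import Mathlib

open scoped Manifold ContDiff

noncomputable section

namespace SprayGeometry

/-- The coordinate space `ℝⁿ`. -/
abbrev Coord (n : ℕ) : Type := EuclideanSpace ℝ (Fin n)

/-- The partial derivative `∂_k f = ∂f/∂x^k` of a function of `(x, y) ∈ ℝⁿ × ℝⁿ`. -/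
def pdx {n : ℕ} (k : Fin n) (f : Coord n × Coord n → ℝ) (p : Coord n × Coord n) : ℝ :=
  fderiv ℝ f p (EuclideanSpace.single k (1 : ℝ), 0)

/-- The partial derivative `∂̇_k f = ∂f/∂y^k` of a function of `(x, y) ∈ ℝⁿ × ℝⁿ`. -/
def pdy {n : ℕ} (k : Fin n) (f : Coord n × Coord n → ℝ) (p : Coord n × Coord n) : ℝ :=
  fderiv ℝ f p (0, EuclideanSpace.single k (1 : ℝ))

/-- The Riemann curvature `R^i_k` of a spray with coefficients `G^i(x, y)`:
`R^i_k = 2 ∂_k G^i - y^j ∂_j ∂̇_k G^i + 2 G^j ∂̇_j ∂̇_k G^i - ∂̇_j G^i ∂̇_k G^j`. -/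
def riemannCoeff {n : ℕ} (G : Fin n → Coord n × Coord n → ℝ) (i k : Fin n)
    (p : Coord n × Coord n) : ℝ :=
  2 * pdx k (G i) p - ∑ j, p.2 j * pdx j (pdy k (G i)) p
    + 2 * ∑ j, G j p * pdy j (pdy k (G i)) p - ∑ j, pdy j (G i) p * pdy k (G j) p

/-- The horizontal derivative `f_{;k} = δ_k f = ∂_k f - G^r_k ∂̇_r f`, `G^r_k = ∂̇_k G^r`, of a
scalar function with respect to the Berwald connection of a spray with coefficients `G^i`. -/
def horizontalDeriv {n : ℕ} (G : Fin n → Coord n × Coord n → ℝ) (k : Fin n)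
    (f : Coord n × Coord n → ℝ) (p : Coord n × Coord n) : ℝ :=
  pdx k f p - ∑ r, pdy k (G r) p * pdy r f p

section Manifold

variable {n : ℕ} {M : Type*} [TopologicalSpace M] [ChartedSpace (Coord n) M]
  [IsManifold (𝓡 n) ∞ M]

/-- The tangent bundle `TM`. -/
abbrev TM (n : ℕ) (M : Type*) [TopologicalSpace M] [ChartedSpace (Coord n) M]
    [IsManifold (𝓡 n) ∞ M] : Type _ :=
  TangentBundle (𝓡 n) M

/-- The fibrewise dilation `y ↦ c y` of `TM`. -/
def dilate (c : ℝ) (v : TM n M) : TM n M := ⟨v.proj, c • v.snd⟩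

/-- The coordinates `(x, y)` on `TM` induced by a chart `φ` of `M`: `x = φ(π v)`, `y = dφ(v)`. -/
def coords (φ : OpenPartialHomeomorph M (Coord n)) (v : TM n M) : Coord n × Coord n :=
  (φ v.proj, mfderiv (𝓡 n) (𝓡 n) φ v.proj v.snd)

/-- The point of `TM` with coordinates `(x, y)` in the chart `φ` of `M` (for `x ∈ φ.target`). -/
def ofCoords (φ : OpenPartialHomeomorph M (Coord n)) (p : Coord n × Coord n) : TM n M :=
  ⟨φ.symm p.1, mfderiv (𝓡 n) (𝓡 n) φ.symm p.1 p.2⟩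

/-- The components `(a, b)` of the tangent vector `a^i ∂/∂x^i + b^i ∂/∂y^i` of `TM` at `v`, in the
coordinates `(x, y)` on `TM` induced by a chart `φ` of `M`. -/
def components (φ : OpenPartialHomeomorph M (Coord n)) (v : TM n M)
    (w : TangentSpace (𝓡 n).tangent v) : Coord n × Coord n :=
  mfderiv (𝓡 n).tangent 𝓘(ℝ, Coord n × Coord n) (coords φ) v w

/-- The coefficient functions `G^i(x, y)`, in the coordinates induced by a chart `φ`, of a vector
field on `TM` of the form `y^i ∂/∂x^i - 2 G^i ∂/∂y^i`. -/
def sprayCoeff (X : (v : TM n M) → TangentSpace (𝓡 n).tangent v)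
    (φ : OpenPartialHomeomorph M (Coord n)) (i : Fin n) (p : Coord n × Coord n) : ℝ :=
  -(1 / 2) * (components φ (ofCoords φ p) (X (ofCoords φ p))).2 i

/-- A spray on the `n`-manifold `M`: a smooth vector field on a conical region of `TM ∖ 0` which in
local coordinates reads `y^i ∂/∂x^i - 2 G^i ∂/∂y^i`, the `G^i(x, y)` being positively homogeneous of
degree two in `y`. The values of `field` outside `domain` are irrelevant. -/
structure Spray (n : ℕ) (M : Type*) [TopologicalSpace M] [ChartedSpace (Coord n) M]
    [IsManifold (𝓡 n) ∞ M] where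
  /-- the conical region of `TM ∖ 0` on which the spray is defined -/
  domain : Set (TM n M)
  isOpen_domain : IsOpen domain
  ne_zero : ∀ v ∈ domain, v.snd ≠ 0
  dilate_mem : ∀ v ∈ domain, ∀ c : ℝ, 0 < c → dilate c v ∈ domain
  /-- the vector field -/
  field : (v : TM n M) → TangentSpace (𝓡 n).tangent v
  smooth : ContMDiffOn (𝓡 n).tangent (𝓡 n).tangent.tangent ∞
    (fun v ↦ (⟨v, field v⟩ : TangentBundle (𝓡 n).tangent (TM n M))) domain
  fst_components : ∀ φ ∈ IsManifold.maximalAtlas (𝓡 n) ∞ M, ∀ v ∈ domain, v.proj ∈ φ.source →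
    (components φ v (field v)).1 = (coords φ v).2
  homogeneous : ∀ φ ∈ IsManifold.maximalAtlas (𝓡 n) ∞ M, ∀ v ∈ domain, v.proj ∈ φ.source →
    ∀ c : ℝ, 0 < c → ∀ i : Fin n,
      sprayCoeff field φ i (coords φ (dilate c v)) = c ^ 2 * sprayCoeff field φ i (coords φ v)

namespace Spray

/-- The spray is R-flat: its Riemann curvature vanishes, `R^i_k = 0`. -/
def IsRFlat (G : Spray n M) : Prop :=
  ∀ φ ∈ IsManifold.maximalAtlas (𝓡 n) ∞ M, ∀ v ∈ G.domain, v.proj ∈ φ.source →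
    ∀ i k : Fin n, riemannCoeff (sprayCoeff G.field φ) i k (coords φ v) = 0

/-- `P` is a Funk function of the spray over the open set `U ⊆ M`: on the part of the conical region
that lies over `U`, `P` is smooth, positively homogeneous of degree one, and `P_{;k} = P P_{.k}`. -/
structure IsFunkFunctionOn (G : Spray n M) (U : Set M) (P : TM n M → ℝ) : Prop where
  smooth : ContMDiffOn (𝓡 n).tangent 𝓘(ℝ, ℝ) ∞ P {v | v ∈ G.domain ∧ v.proj ∈ U}
  homogeneous : ∀ v ∈ G.domain, v.proj ∈ U → ∀ c : ℝ, 0 < c → P (dilate c v) = c * P v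
  funk : ∀ φ ∈ IsManifold.maximalAtlas (𝓡 n) ∞ M, ∀ v ∈ G.domain, v.proj ∈ U →
    v.proj ∈ φ.source → ∀ k : Fin n,
      horizontalDeriv (sprayCoeff G.field φ) k (P ∘ ofCoords φ) (coords φ v)
        = P v * pdy k (P ∘ ofCoords φ) (coords φ v)

end Spray

end Manifold

end SprayGeometry

end

open Set Filter Topology

-- With `N e = D_y G e`, the Funk equation reads `dP(e, -N e - P e) = 0` for every `e`. It is an
-- overdetermined first-order quasilinear system whose solutions are constant along the curves with
-- velocity `(e, -N e - P e)`. The values `φ` of `P` over `x₀` can be prescribed once the system is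
-- integrable. Integrability needs `D_y N` to be symmetric, which holds because second derivatives
-- of `G` commute, and the nonlinear connection `N` to be flat. Flatness follows from `R = 0`,
-- because the curvature of `N` is one third of the antisymmetrised vertical derivative of `R`
-- (`sprayConnection_flat`).
--
-- The system is integrated along segments issuing from `x₀`. Since `P` keeps its initial value on a
-- characteristic, the characteristic through `(x, y)` solves `u' = -N(u) ξ - φ(u(0)) ξ`, `u(1) =
-- y`, with `ξ = x - x₀`, and `P(x, y) = φ(u(0))`. The term `u(0)` makes this nonlocal, so it is
-- solved as a fixed point in `C([0,1], E)` depending smoothly on `(x, y)`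
-- (`exists_radialTransport`). The equation then holds for radial `e`, and a linear ODE along the
-- segment carries it to all `e` (`horizontal_eq_zero_of_radial`).
--
-- For homogeneity, `φ` is taken 1-homogeneous near `y₀` and supported in a thin cone. The solution
-- is then homogeneous near `y₀`, and its restriction to a hyperplane slice extends by homogeneity
-- inside a cone and by zero outside (`exists_funk_coordinates`). Finally the equation does not
-- depend on the chart (`funk_of_funk_chart`).

universe u

/-! ### Smoothness of composition operators on spaces of paths. -/

section Superposition

variable {K : Type*} [TopologicalSpace K] [CompactSpace K]

/-- The pointwise application of a continuous family of operators to a continuous family of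
vectors, as a bounded bilinear map. -/
noncomputable def ContinuousMap.pointwiseApply (K : Type*) [TopologicalSpace K] [CompactSpace K]
    (E F : Type*) [NormedAddCommGroup E] [NormedSpace ℝ E] [NormedAddCommGroup F]
    [NormedSpace ℝ F] : C(K, E →L[ℝ] F) →L[ℝ] C(K, E) →L[ℝ] C(K, F) :=
  LinearMap.mkContinuous₂
    (LinearMap.mk₂ ℝ (fun (A : C(K, E →L[ℝ] F)) (u : C(K, E)) ↦
        (⟨fun t ↦ A t (u t), A.continuous.clm_apply u.continuous⟩ : C(K, F)))
      (fun _ _ _ ↦ by ext; simp) (fun _ _ _ ↦ by ext; simp)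
      (fun _ _ _ ↦ by ext; simp) (fun _ _ _ ↦ by ext; simp)) 1
    (fun A u ↦ by
      rw [one_mul, ContinuousMap.norm_le _ (by positivity)]
      intro t
      exact ((A t).le_opNorm (u t)).trans (mul_le_mul (A.norm_coe_le_norm t)
        (u.norm_coe_le_norm t) (norm_nonneg _) (norm_nonneg A)))

@[simp] theorem ContinuousMap.pointwiseApply_apply {E F : Type*} [NormedAddCommGroup E]
    [NormedSpace ℝ E] [NormedAddCommGroup F] [NormedSpace ℝ F] (A : C(K, E →L[ℝ] F))
    (u : C(K, E)) (t : K) : ContinuousMap.pointwiseApply K E F A u t = A t (u t) := rfl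

/-- The superposition operator `u ↦ f ∘ u` of a `C¹` function is differentiable. -/
theorem ContinuousMap.hasFDerivAt_comp_left {E F : Type*} [NormedAddCommGroup E]
    [NormedSpace ℝ E] [NormedAddCommGroup F] [NormedSpace ℝ F] (f : C(E, F))
    (f' : C(E, E →L[ℝ] F)) (hf : ∀ x, HasFDerivAt f (f' x) x) (u : C(K, E)) :
    HasFDerivAt (fun v : C(K, E) ↦ f.comp v)
      (ContinuousMap.pointwiseApply K E F (f'.comp u)) u := by
  rw [hasFDerivAt_iff_isLittleO_nhds_zero, Asymptotics.isLittleO_iff]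
  intro c hc
  -- Compactness of `K` enters here: `v ↦ f' ∘ v` is continuous in the sup norm, which replaces
  -- uniform continuity of `f'` on bounded sets.
  have hcont : Tendsto (fun v : C(K, E) ↦ f'.comp v) (𝓝 u) (𝓝 (f'.comp u)) :=
    (ContinuousMap.continuous_postcomp f').tendsto u
  obtain ⟨δ, hδ, hball⟩ := Metric.eventually_nhds_iff.1
    (hcont.eventually (Metric.ball_mem_nhds (f'.comp u) hc))
  filter_upwards [Metric.ball_mem_nhds (0 : C(K, E)) hδ] with h hh
  rw [mem_ball_zero_iff] at hh
  rw [ContinuousMap.norm_le _ (by positivity)]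
  intro t
  have key : ∀ w ∈ Metric.ball (u t) δ, ‖f' w - f' (u t)‖ ≤ c := by
    intro w hw
    -- A vector near `u t` is the value at `t` of a constant translate of `u`, which is near `u` in
    -- the sup norm.
    have hd : dist (u + ContinuousMap.const K (w - u t)) u < δ := by
      rw [dist_eq_norm, add_sub_cancel_left]
      refine lt_of_le_of_lt ((ContinuousMap.norm_le _ (norm_nonneg (w - u t))).2 fun s ↦ ?_)
        (by simpa [dist_eq_norm] using hw)
      simp
    have := (ContinuousMap.dist_apply_le_dist (f := f'.comp (u + ContinuousMap.const K (w - u t)))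
      (g := f'.comp u) t).trans (hball hd).le
    simpa [dist_eq_norm] using this
  have hmv := (convex_ball (u t) δ).norm_image_sub_le_of_norm_hasFDerivWithin_le'
    (f := f) (f' := f') (φ := f' (u t)) (C := c) (x := u t) (y := u t + h t)
    (fun x _ ↦ (hf x).hasFDerivWithinAt) key (Metric.mem_ball_self hδ)
    (by simpa [dist_eq_norm] using (h.norm_coe_le_norm t).trans_lt hh)
  rw [add_sub_cancel_left] at hmv
  exact hmv.trans (mul_le_mul_of_nonneg_left (h.norm_coe_le_norm t) hc.le)

/-- The derivative at `u` is pointwise application of `f' ∘ u`, again a composition operator, now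
with values in `E →L[ℝ] F`. The induction therefore varies the target, and `E`, `F` share a universe
so that `E →L[ℝ] F` stays in it. -/
theorem ContinuousMap.contDiff_comp_left_nat (n : ℕ) : ∀ {E F : Type u} [NormedAddCommGroup E]
    [NormedSpace ℝ E] [NormedAddCommGroup F] [NormedSpace ℝ F] (f : C(E, F)),
    ContDiff ℝ n f → ContDiff ℝ n (fun v : C(K, E) ↦ f.comp v) := by
  induction n with
  | zero =>
    intro E F _ _ _ _ f _
    exact contDiff_zero.2 (ContinuousMap.continuous_postcomp f)
  | succ n ih =>
    intro E F _ _ _ _ f hf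
    push_cast at hf ⊢
    obtain ⟨-, -, hd⟩ := contDiff_succ_iff_fderiv.1 hf
    have h1 : ∀ x, HasFDerivAt f (fderiv ℝ f x) x := fun x ↦
      (hf.differentiable (by simp) x).hasFDerivAt
    rw [contDiff_succ_iff_hasFDerivAt]
    refine ⟨_, (ContinuousMap.pointwiseApply K E F).contDiff.comp
      (ih ⟨fderiv ℝ f, hd.continuous⟩ hd), fun u ↦ ?_⟩
    exact ContinuousMap.hasFDerivAt_comp_left f ⟨fderiv ℝ f, hd.continuous⟩ h1 u

/-- The superposition operator `u ↦ f ∘ u` of a smooth function is smooth. -/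
theorem ContinuousMap.contDiff_comp_left {E F : Type u} [NormedAddCommGroup E]
    [NormedSpace ℝ E] [NormedAddCommGroup F] [NormedSpace ℝ F] (f : C(E, F))
    (hf : ContDiff ℝ ∞ f) : ContDiff ℝ ∞ (fun v : C(K, E) ↦ f.comp v) := by
  rw [contDiff_infty] at hf ⊢
  exact fun n ↦ ContinuousMap.contDiff_comp_left_nat n f (hf n)

end Superposition

/-! ### Smooth dependence of fixed points of contractions. -/

section FixedPoint

variable {X B : Type*} [NormedAddCommGroup X] [NormedSpace ℝ X] [CompleteSpace X]
  [NormedAddCommGroup B] [NormedSpace ℝ B] [CompleteSpace B]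

/-- The fixed point of a smooth family of uniform contractions depends smoothly on the
parameter. -/
theorem exists_contDiffOn_fixedPoint {F : X × B → B} {s : Set X} (hs : IsOpen s)
    (hF : ContDiffOn ℝ ∞ F (s ×ˢ univ))
    (hc : ∀ x ∈ s, LipschitzWith (1 / 2) (fun u ↦ F (x, u))) :
    ∃ g : X → B, ContDiffOn ℝ ∞ g s ∧ ∀ x ∈ s, ∀ u, F (x, u) = u ↔ u = g x := by
  have hc' : ∀ x ∈ s, ContractingWith (1 / 2) (fun u ↦ F (x, u)) := fun x hx ↦
    ⟨by norm_num, hc x hx⟩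
  classical
  let g : X → B := fun x ↦ if hx : x ∈ s then (hc' x hx).fixedPoint else 0
  have hg : ∀ x ∈ s, ∀ u, F (x, u) = u ↔ u = g x := by
    intro x hx u
    simp only [g, dif_pos hx]
    exact ⟨fun h ↦ (hc' x hx).fixedPoint_unique h,
      fun h ↦ by rw [h]; exact (hc' x hx).fixedPoint_isFixedPt⟩
  refine ⟨g, fun x hx ↦ ContDiffAt.contDiffWithinAt ?_, hg⟩
  have hFx : ContDiffAt ℝ ∞ F (x, g x) :=
    hF.contDiffAt ((hs.prod isOpen_univ).mem_nhds ⟨hx, mem_univ _⟩)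
  have hH : ContDiffAt ℝ ∞ (fun q : X × B ↦ q.2 - F q) (x, g x) := contDiffAt_snd.sub hFx
  have hder : fderiv ℝ (fun q : X × B ↦ q.2 - F q) (x, g x) ∘L .inr ℝ X B
      = 1 - fderiv ℝ (fun u ↦ F (x, u)) (g x) := by
    have h1 : HasFDerivAt F (fderiv ℝ F (x, g x)) (x, g x) :=
      (hFx.differentiableAt (by simp)).hasFDerivAt
    have h2 : HasFDerivAt (fun u ↦ F (x, u)) (fderiv ℝ F (x, g x) ∘L .inr ℝ X B) (g x) :=
      h1.comp (g x) (hasFDerivAt_prodMk_right x (g x))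
    rw [HasFDerivAt.fderiv (f := fun q : X × B ↦ q.2 - F q) (hasFDerivAt_snd.sub h1), h2.fderiv]
    ext v
    simp
  -- The partial derivative in `u` is `1 - D_u F` with `‖D_u F‖ ≤ 1/2`, hence invertible by the
  -- Neumann series.
  have hinv : (fderiv ℝ (fun q : X × B ↦ q.2 - F q) (x, g x) ∘L .inr ℝ X B).IsInvertible := by
    have hn : ‖fderiv ℝ (fun u ↦ F (x, u)) (g x)‖ < 1 :=
      (norm_fderiv_le_of_lipschitz ℝ (hc x hx)).trans_lt (by norm_num)
    rw [hder]
    exact ⟨ContinuousLinearEquiv.unitsEquiv ℝ B (Units.oneSub _ hn), rfl⟩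
  have hsm := hH.contDiffAt_implicitFunction (by simp) hinv
  -- The local implicit function also consists of fixed points, so uniqueness identifies it with
  -- `g`.
  refine hsm.congr_of_eventuallyEq ?_
  filter_upwards [hH.eventually_apply_implicitFunction (by simp) hinv, hs.mem_nhds hx]
    with y hy hys
  have h0 : F (x, g x) = g x := (hg x hx _).2 rfl
  simp only [h0, sub_self] at hy
  exact ((hg y hys _).1 (sub_eq_zero.1 hy).symm).symm

end FixedPoint

/-! ### The radial transport equation as a fixed point problem. -/

section RadialTransport

variable {E : Type u} [NormedAddCommGroup E]

/-- The value at `s` of a path on `[0, 1]`, extended by its end values. -/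
noncomputable def pathAt (u : C(unitInterval, E)) (s : ℝ) : E := u (projIcc 0 1 zero_le_one s)

theorem continuous_pathAt (u : C(unitInterval, E)) : Continuous (pathAt u) :=
  u.continuous.comp continuous_projIcc

@[simp] theorem pathAt_coe (u : C(unitInterval, E)) (t : unitInterval) : pathAt u t = u t := by
  simp [pathAt]

theorem norm_pathAt_le (u : C(unitInterval, E)) (s : ℝ) : ‖pathAt u s‖ ≤ ‖u‖ :=
  u.norm_coe_le_norm _

variable [NormedSpace ℝ E]

/-- The operator `v ↦ (t ↦ ∫ s in t..1, v s)` on paths. -/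
noncomputable def tailIntegral (E : Type u) [NormedAddCommGroup E] [NormedSpace ℝ E] :
    C(unitInterval, E) →L[ℝ] C(unitInterval, E) :=
  LinearMap.mkContinuous
    { toFun := fun v ↦ ⟨fun t ↦ ∫ s in (t : ℝ)..1, pathAt v s, by
        have h := (intervalIntegral.continuous_primitive
          (fun a b ↦ (continuous_pathAt v).intervalIntegrable (μ := MeasureTheory.volume) a b)
          1).neg
        refine (h.comp continuous_subtype_val).congr fun t ↦ ?_
        exact (intervalIntegral.integral_symm _ _).symm⟩
      map_add' := fun v w ↦ by
        ext t
        exact intervalIntegral.integral_add ((continuous_pathAt v).intervalIntegrable _ _)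
          ((continuous_pathAt w).intervalIntegrable _ _)
      map_smul' := fun c v ↦ by
        ext t
        exact intervalIntegral.integral_smul c _ } 1
    (fun v ↦ by
      rw [one_mul, ContinuousMap.norm_le _ (norm_nonneg v)]
      intro t
      refine (intervalIntegral.norm_integral_le_of_norm_le_const
        (fun s _ ↦ norm_pathAt_le v s)).trans ?_
      refine mul_le_of_le_one_right (norm_nonneg v) ?_
      rw [abs_of_nonneg (by linarith [t.2.2])]
      linarith [t.2.1])

theorem tailIntegral_apply (v : C(unitInterval, E)) (t : unitInterval) :
    tailIntegral E v t = ∫ s in (t : ℝ)..1, pathAt v s := rfl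

theorem norm_tailIntegral_le (v : C(unitInterval, E)) : ‖tailIntegral E v‖ ≤ ‖v‖ := by
  simpa using (tailIntegral E).le_of_opNorm_le (LinearMap.mkContinuous_norm_le _ zero_le_one _) v

/-- `u` solves `u' = -A(x₀ + t (x - x₀), u, u(0)) (x - x₀)` on `[0, 1]` with `u(1) = y`. -/
def IsRadialTransport (A : E × E × E → E →L[ℝ] E) (x₀ x y : E) (u : C(unitInterval, E)) : Prop :=
  ∀ t : unitInterval, u t = y + ∫ s in (t : ℝ)..1,
    A (x₀ + s • (x - x₀), pathAt u s, pathAt u 0) (x - x₀)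

/-- The affine part of the integrand of the radial transport equation: the path
`s ↦ (x₀ + s ξ, u s, u 0, ξ)`. -/
noncomputable def radialCurve (x₀ : E) (q : E × C(unitInterval, E)) :
    C(unitInterval, (E × E × E) × E) :=
  ⟨fun s ↦ ((x₀ + (s : ℝ) • q.1, q.2 s, q.2 0), q.1), by fun_prop⟩

theorem contDiff_radialCurve (x₀ : E) : ContDiff ℝ ∞ (radialCurve x₀) := by
  let l : E × C(unitInterval, E) →ₗ[ℝ] C(unitInterval, (E × E × E) × E) :=
    { toFun := fun q ↦ ⟨fun s ↦ (((s : ℝ) • q.1, q.2 s, q.2 0), q.1), by fun_prop⟩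
      map_add' := fun q r ↦ by ext s <;> simp
      map_smul' := fun c q ↦ by
        ext s
        · exact smul_comm _ _ _
        all_goals rfl }
  have hl : ∀ q, ‖l q‖ ≤ 1 * ‖q‖ := by
    intro q
    rw [one_mul, ContinuousMap.norm_le _ (norm_nonneg q)]
    intro s
    have h1 : ‖q.1‖ ≤ ‖q‖ := norm_fst_le q
    have h2 : ∀ t, ‖q.2 t‖ ≤ ‖q‖ := fun t ↦ (q.2.norm_coe_le_norm t).trans (norm_snd_le q)
    have h3 : ‖(s : ℝ) • q.1‖ ≤ ‖q‖ := by
      rw [norm_smul, Real.norm_of_nonneg s.2.1]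
      exact (mul_le_of_le_one_left (norm_nonneg _) s.2.2).trans h1
    change ‖((((s : ℝ) • q.1, q.2 s, q.2 0), q.1) : (E × E × E) × E)‖ ≤ ‖q‖
    simp only [Prod.norm_mk, sup_le_iff]
    exact ⟨⟨h3, h2 s, h2 0⟩, h1⟩
  have : radialCurve x₀ = fun q ↦ l.mkContinuous 1 hl q +
      ContinuousMap.const unitInterval ((x₀, 0, 0), 0) := by
    funext q
    ext s <;> simp [radialCurve, l, add_comm]
  rw [this]
  exact (l.mkContinuous 1 hl).contDiff.add contDiff_const

/-- The radial transport equation has a unique solution, depending smoothly on its data, over a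
uniform neighbourhood of the centre. -/
theorem exists_radialTransport [CompleteSpace E] {A : E × E × E → E →L[ℝ] E}
    (hA : ContDiff ℝ ∞ A) {C : ℝ} (hC : ∀ q, ‖A q‖ ≤ C) {L : NNReal} (hL : LipschitzWith L A)
    (x₀ : E) {ε : ℝ} (hε : 0 < ε) :
    ∃ δ > 0, δ ≤ ε ∧ ∃ u : E × E → C(unitInterval, E),
      ContDiffOn ℝ ∞ u (Metric.ball x₀ δ ×ˢ univ) ∧
      (∀ x ∈ Metric.ball x₀ δ, ∀ y v, IsRadialTransport A x₀ x y v ↔ v = u (x, y)) ∧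
      ∀ x ∈ Metric.ball x₀ δ, ∀ y t, ‖u (x, y) t - y‖ ≤ ε := by
  have hC0 : 0 ≤ C := (norm_nonneg _).trans (hC 0)
  obtain ⟨δ, hδ, hδL, hδC, hδε⟩ : ∃ δ > (0 : ℝ), L * δ ≤ 1 / 2 ∧ C * δ ≤ ε ∧ δ ≤ ε := by
    -- The first bound makes the integral operator a contraction with constant 1/2; the second keeps
    -- solutions within `ε` of `y`. Adding 1 avoids division by zero.
    refine ⟨min (1 / 2 / ((L : ℝ) + 1)) (ε / (C + 1)), by positivity, ?_, ?_,
      (min_le_right _ _).trans (div_le_self hε.le (by linarith))⟩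
    · calc (L : ℝ) * min (1 / 2 / ((L : ℝ) + 1)) (ε / (C + 1)) ≤ ((L : ℝ) + 1) * (1 / 2 / (L + 1)) := by
            gcongr
            · linarith
            · exact min_le_left _ _
        _ = 1 / 2 := by field_simp
    · calc C * min (1 / 2 / ((L : ℝ) + 1)) (ε / (C + 1)) ≤ (C + 1) * (ε / (C + 1)) := by
            gcongr
            · linarith
            · exact min_le_right _ _
        _ = ε := by field_simp
  let k : C((E × E × E) × E, E) := ⟨fun q ↦ A q.1 q.2, by
    have := hA.continuous
    fun_prop⟩
  have hk : ContDiff ℝ ∞ k := (hA.comp contDiff_fst).clm_apply contDiff_snd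
  let T : (E × E) × C(unitInterval, E) → C(unitInterval, E) := fun q ↦
    ContinuousMap.const unitInterval q.1.2
      + tailIntegral E (k.comp (radialCurve x₀ (q.1.1 - x₀, q.2)))
  have hT : ContDiff ℝ ∞ T := by
    refine ContDiff.add ?_ ((tailIntegral E).contDiff.comp
      ((ContinuousMap.contDiff_comp_left k hk).comp ((contDiff_radialCurve x₀).comp
        ((contDiff_fst.fst.sub contDiff_const).prodMk contDiff_snd))))
    exact ((ContinuousLinearMap.const ℝ unitInterval (M := E)).contDiff).comp contDiff_fst.snd
  have hTu : ∀ x y v, T ((x, y), v) = v ↔ IsRadialTransport A x₀ x y v := by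
    intro x y v
    rw [ContinuousMap.ext_iff]
    refine forall_congr' fun t ↦ ?_
    have : T ((x, y), v) t = y + ∫ s in (t : ℝ)..1,
        A (x₀ + s • (x - x₀), pathAt v s, pathAt v 0) (x - x₀) := by
      simp only [T, ContinuousMap.add_apply, ContinuousMap.const_apply, tailIntegral_apply]
      congr 1
      refine intervalIntegral.integral_congr fun s hs ↦ ?_
      rw [uIcc_of_le t.2.2] at hs
      have hs' : s ∈ Icc (0 : ℝ) 1 := ⟨t.2.1.trans hs.1, hs.2⟩
      simp [pathAt, k, radialCurve, projIcc_of_mem zero_le_one hs']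
    rw [this]
    exact eq_comm
  obtain ⟨u, hu, hfix⟩ := exists_contDiffOn_fixedPoint (F := T)
    (s := Metric.ball x₀ δ ×ˢ (univ : Set E)) (Metric.isOpen_ball.prod isOpen_univ)
    hT.contDiffOn (by
      rintro ⟨x, y⟩ ⟨hx, -⟩
      refine LipschitzWith.of_dist_le_mul fun v w ↦ ?_
      rw [dist_eq_norm, dist_eq_norm]
      simp only [T, add_sub_add_left_eq_sub, ← map_sub]
      refine (norm_tailIntegral_le _).trans ?_
      rw [ContinuousMap.norm_le _ (by positivity)]
      intro s
      have hx' : ‖x - x₀‖ ≤ δ := by simpa [dist_eq_norm] using (Metric.mem_ball.1 hx).le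
      have hA' : ‖A (x₀ + (s : ℝ) • (x - x₀), v s, v 0) - A (x₀ + (s : ℝ) • (x - x₀), w s, w 0)‖
          ≤ L * ‖v - w‖ := by
        refine (hL.norm_sub_le _ _).trans ?_
        gcongr
        simp only [Prod.mk_sub_mk, sub_self, Prod.norm_mk, norm_zero, sup_le_iff]
        exact ⟨norm_nonneg _, (v - w).norm_coe_le_norm s, (v - w).norm_coe_le_norm 0⟩
      calc ‖A (x₀ + (s : ℝ) • (x - x₀), v s, v 0) (x - x₀)
            - A (x₀ + (s : ℝ) • (x - x₀), w s, w 0) (x - x₀)‖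
          ≤ (L * ‖v - w‖) * δ := by
            rw [← sub_apply]
            exact (ContinuousLinearMap.le_opNorm _ _).trans (by gcongr)
        _ = (L * δ) * ‖v - w‖ := by ring
        _ ≤ ((1 / 2 : NNReal) : ℝ) * ‖v - w‖ := by
            push_cast
            gcongr)
  refine ⟨δ, hδ, hδε, u, hu, fun x hx y v ↦ ?_, fun x hx y t ↦ ?_⟩
  · rw [← hTu]
    exact hfix (x, y) ⟨hx, mem_univ _⟩ v
  · have h := (hTu x y _).1 ((hfix (x, y) ⟨hx, mem_univ _⟩ _).2 rfl) t
    have hx' : ‖x - x₀‖ ≤ δ := by simpa [dist_eq_norm] using (Metric.mem_ball.1 hx).le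
    rw [h, add_sub_cancel_left]
    refine (intervalIntegral.norm_integral_le_of_norm_le_const (C := C * δ) fun s _ ↦ ?_).trans ?_
    · exact (ContinuousLinearMap.le_opNorm _ _).trans (by gcongr; exact hC _)
    · refine (mul_le_of_le_one_right (by positivity) ?_).trans hδC
      rw [abs_of_nonneg (by linarith [t.2.2])]
      linarith [t.2.1]

end RadialTransport

/-! ### Differential form and rescaling of radial solutions. -/

section RadialTransportProperties

variable {E : Type u} [NormedAddCommGroup E] [NormedSpace ℝ E]

theorem continuous_radialIntegrand {A : E × E × E → E →L[ℝ] E} (hA : Continuous A) (x₀ x : E)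
    (u : C(unitInterval, E)) :
    Continuous fun s : ℝ ↦ A (x₀ + s • (x - x₀), pathAt u s, pathAt u 0) (x - x₀) := by
  have := continuous_pathAt u
  fun_prop

theorem IsRadialTransport.hasDerivWithinAt [CompleteSpace E] {A : E × E × E → E →L[ℝ] E}
    (hA : Continuous A) {x₀ x y : E} {u : C(unitInterval, E)} (hu : IsRadialTransport A x₀ x y u)
    {t : ℝ} (ht : t ∈ Icc (0 : ℝ) 1) :
    HasDerivWithinAt (pathAt u)
      (-(A (x₀ + t • (x - x₀), pathAt u t, pathAt u 0) (x - x₀))) (Icc 0 1) t := by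
  have hc := continuous_radialIntegrand hA x₀ x u
  have h := (intervalIntegral.integral_hasDerivAt_left (hc.intervalIntegrable t 1)
    (hc.stronglyMeasurableAtFilter _ _) hc.continuousAt).const_add y
  refine h.hasDerivWithinAt.congr_of_mem (fun s hs ↦ ?_) ht
  have := hu ⟨s, hs⟩
  rw [← pathAt_coe] at this
  exact this

theorem IsRadialTransport.apply_one {A : E × E × E → E →L[ℝ] E} {x₀ x y : E}
    {u : C(unitInterval, E)} (hu : IsRadialTransport A x₀ x y u) : u 1 = y := by
  simpa using hu 1

/-- Restricting a radial solution to `[0, t]` and rescaling gives a radial solution. -/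
theorem IsRadialTransport.restrict {A : E × E × E → E →L[ℝ] E} (hA : Continuous A) {x₀ x y : E}
    {u : C(unitInterval, E)} (hu : IsRadialTransport A x₀ x y u) (t : unitInterval) :
    IsRadialTransport A x₀ (x₀ + (t : ℝ) • (x - x₀)) (u t)
      (u.comp ⟨fun s ↦ t * s, by fun_prop⟩) := by
  intro s
  have hc := continuous_radialIntegrand hA x₀ x u
  set g := fun s : ℝ ↦ A (x₀ + s • (x - x₀), pathAt u s, pathAt u 0) (x - x₀) with hg
  have h1 : u (t * s) = y + ∫ σ in ((t * s : unitInterval) : ℝ)..1, g σ := hu (t * s)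
  have h2 : u t = y + ∫ σ in (t : ℝ)..1, g σ := hu t
  -- Substitution `σ = t τ`; the factor `t` is absorbed by the shortened increment `t (x - x₀)`. The
  -- initial value `u 0` is unchanged by the restriction.
  have h3 : ∫ τ in (s : ℝ)..1, (t : ℝ) • g (t * τ) = ∫ σ in ((t * s : unitInterval) : ℝ)..t, g σ := by
    rw [intervalIntegral.integral_smul, intervalIntegral.smul_integral_comp_mul_left, mul_one]
    rfl
  have h4 : ∫ τ in (s : ℝ)..1, (t : ℝ) • g (t * τ) = ∫ τ in (s : ℝ)..1,
      A (x₀ + τ • (x₀ + (t : ℝ) • (x - x₀) - x₀),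
        pathAt (u.comp ⟨fun s ↦ t * s, by fun_prop⟩) τ,
        pathAt (u.comp ⟨fun s ↦ t * s, by fun_prop⟩) 0) (x₀ + (t : ℝ) • (x - x₀) - x₀) := by
    refine intervalIntegral.integral_congr fun τ hτ ↦ ?_
    rw [uIcc_of_le s.2.2] at hτ
    have hτ' : τ ∈ Icc (0 : ℝ) 1 := ⟨s.2.1.trans hτ.1, hτ.2⟩
    have e1 : pathAt (u.comp ⟨fun s ↦ t * s, by fun_prop⟩) τ = pathAt u (t * τ) := by
      have := pathAt_coe u (t * ⟨τ, hτ'⟩)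
      rw [show ((t * ⟨τ, hτ'⟩ : unitInterval) : ℝ) = t * τ from rfl] at this
      rw [this]
      simp [pathAt, projIcc_of_mem zero_le_one hτ']
    have e2 : pathAt (u.comp ⟨fun s ↦ t * s, by fun_prop⟩) 0 = pathAt u 0 := by
      simp [pathAt]
    simp only [hg]
    rw [e1, e2, add_sub_cancel_left, smul_smul, mul_comm τ, map_smul]
  rw [← h4, h3, h2, add_assoc,
    add_comm (∫ σ in (t : ℝ)..1, g σ),
    intervalIntegral.integral_add_adjacent_intervals (hc.intervalIntegrable _ _)
      (hc.intervalIntegrable _ _), ← h1]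
  rfl

end RadialTransportProperties

/-! ### From the radial direction to all directions. -/

section RadialUniqueness

variable {E : Type u} [NormedAddCommGroup E] [NormedSpace ℝ E]

/-- A function which satisfies the equation `dp(e, -f e - p e) = 0` in the radial direction
satisfies it in all directions, provided that the connection `f` is symmetric and flat. -/
theorem horizontal_eq_zero_of_radial {p : E × E → ℝ} {f : E × E → E →L[ℝ] E} {W : Set (E × E)}
    (hW : IsOpen W) (hp : ContDiffOn ℝ ∞ p W) (hf : ContDiffOn ℝ ∞ f W)
    (hsym : ∀ q ∈ W, ∀ e ξ, fderiv ℝ f q (0, e) ξ = fderiv ℝ f q (0, ξ) e)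
    (hcurv : ∀ q ∈ W, ∀ e ξ, fderiv ℝ f q (e, -f q e) ξ = fderiv ℝ f q (ξ, -f q ξ) e)
    {x₀ ξ : E} (hrad : ∀ q ∈ W, fderiv ℝ p q
      (q.1 - x₀, -f q (q.1 - x₀) - p q • (q.1 - x₀)) = 0)
    {u : ℝ → E} (hmem : ∀ t ∈ Icc (0 : ℝ) 1, (x₀ + t • ξ, u t) ∈ W)
    (hu : ∀ t ∈ Icc (0 : ℝ) 1, HasDerivWithinAt u
      (-f (x₀ + t • ξ, u t) ξ - p (x₀ + t • ξ, u t) • ξ) (Icc 0 1) t) (e : E) :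
    fderiv ℝ p (x₀ + ξ, u 1)
      (e, -f (x₀ + ξ, u 1) e - p (x₀ + ξ, u 1) • e) = 0 := by
  set c : ℝ → E × E := fun t ↦ (x₀ + t • ξ, u t) with hc
  set Ξ : E × E → ℝ := fun q ↦ fderiv ℝ p q (e, -f q e - p q • e) with hΞ
  have hcd : ∀ t ∈ Icc (0 : ℝ) 1,
      HasDerivWithinAt c (ξ, -f (c t) ξ - p (c t) • ξ) (Icc 0 1) t := by
    intro t ht
    have h1 : HasDerivWithinAt (fun t : ℝ ↦ x₀ + t • ξ) ξ (Icc 0 1) t := by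
      simpa using (((hasDerivAt_id t).smul_const ξ).const_add x₀).hasDerivWithinAt
    exact h1.prodMk (hu t ht)
  have hccont : ContinuousOn c (Icc 0 1) := fun t ht ↦ (hcd t ht).continuousWithinAt
  have hpd : ∀ q ∈ W, HasFDerivAt p (fderiv ℝ p q) q := fun q hq ↦
    ((hp.contDiffAt (hW.mem_nhds hq)).differentiableAt (by simp)).hasFDerivAt
  have hfd : ∀ q ∈ W, HasFDerivAt f (fderiv ℝ f q) q := fun q hq ↦
    ((hf.contDiffAt (hW.mem_nhds hq)).differentiableAt (by simp)).hasFDerivAt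
  have hdp : ContDiffOn ℝ ∞ (fderiv ℝ p) W := hp.fderiv_of_isOpen hW (by simp)
  have hppd : ∀ q ∈ W, HasFDerivAt (fderiv ℝ p) (fderiv ℝ (fderiv ℝ p) q) q := fun q hq ↦
    ((hdp.contDiffAt (hW.mem_nhds hq)).differentiableAt (by simp)).hasFDerivAt
  have hHsym : ∀ q ∈ W, ∀ v w, fderiv ℝ (fderiv ℝ p) q v w = fderiv ℝ (fderiv ℝ p) q w v := by
    intro q hq v w
    exact ((hp.contDiffAt (hW.mem_nhds hq)).isSymmSndFDerivAt
      (by simpa using WithTop.coe_le_coe.2 (le_top : (2 : ℕ∞) ≤ ⊤))) v w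
  have hΞd : ∀ q ∈ W, ∀ w, HasFDerivAt Ξ (fderiv ℝ Ξ q) q ∧ fderiv ℝ Ξ q w
      = fderiv ℝ (fderiv ℝ p) q w (e, -f q e - p q • e)
        + fderiv ℝ p q (0, -fderiv ℝ f q w e - fderiv ℝ p q w • e) := by
    intro q hq w
    have h := (hppd q hq).clm_apply ((hasFDerivAt_const e q).prodMk
      (((hfd q hq).clm_apply (hasFDerivAt_const e q)).neg.sub ((hpd q hq).smul_const e)))
    have h' : HasFDerivAt Ξ _ q := h
    refine ⟨h'.differentiableAt.hasFDerivAt, ?_⟩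
    rw [h'.fderiv]
    simp [add_comm]
  -- The radial equation differentiated in an arbitrary direction `w`; the base point dependence of
  -- `q.1 - x₀` contributes the terms containing `w.1`.
  have hradd : ∀ q ∈ W, ∀ w, fderiv ℝ (fderiv ℝ p) q w
        (q.1 - x₀, -f q (q.1 - x₀) - p q • (q.1 - x₀))
      + fderiv ℝ p q (w.1, -fderiv ℝ f q w (q.1 - x₀) - f q w.1
        - fderiv ℝ p q w • (q.1 - x₀) - p q • w.1) = 0 := by
    intro q hq w
    have hx : HasFDerivAt (fun q : E × E ↦ q.1 - x₀) (ContinuousLinearMap.fst ℝ E E) q :=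
      hasFDerivAt_fst.sub_const x₀
    have h := (hppd q hq).clm_apply (hx.prodMk
      (((hfd q hq).clm_apply hx).neg.sub ((hpd q hq).smul hx)))
    have h0 : HasFDerivAt (fun q : E × E ↦ fderiv ℝ p q
      (q.1 - x₀, -f q (q.1 - x₀) - p q • (q.1 - x₀))) 0 q :=
      (hasFDerivAt_const (𝕜 := ℝ) (0 : ℝ) q).congr_of_eventuallyEq
        (by filter_upwards [hW.mem_nhds hq] with r hr using hrad r hr)
    have := congrArg (fun l : E × E →L[ℝ] ℝ ↦ l w) (h.unique h0)
    simp only [add_apply, ContinuousLinearMap.comp_apply, ContinuousLinearMap.prod_apply,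
      ContinuousLinearMap.flip_apply, ContinuousLinearMap.coe_fst', sub_apply, neg_apply,
      smul_apply, ContinuousLinearMap.smulRight_apply, Pi.sub_apply, Pi.neg_apply,
      Pi.smul_apply', zero_apply] at this
    rw [← this, add_comm]
    congr 3
    abel
  obtain ⟨K, hK⟩ : ∃ K, ∀ t ∈ Icc (0 : ℝ) 1, ‖fderiv ℝ p (c t) (0, ξ)‖ ≤ K := by
    refine isCompact_Icc.exists_bound_of_continuousOn ?_
    exact (hdp.continuousOn.comp hccont hmem).clm_apply continuousOn_const
  -- The weight `t` matters twice: on the curve the radial vector is `t ξ`, so `hradd` produces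
  -- exactly the extra `Ξ` in `(t Ξ)'`, and `t Ξ` vanishes at `t = 0` whatever `Ξ` is there.
  have hg : ∀ t ∈ Icc (0 : ℝ) 1, HasDerivWithinAt (fun t ↦ t * Ξ (c t))
      (fderiv ℝ p (c t) (0, ξ) * (t * Ξ (c t))) (Icc 0 1) t := by
    intro t ht
    have hq : c t ∈ W := hmem t ht
    have h1 := (hasDerivWithinAt_id t (Icc 0 1)).mul
      ((hΞd (c t) hq 0).1.comp_hasDerivWithinAt t (hcd t ht))
    refine h1.congr_deriv ?_
    have hfst : (c t).1 - x₀ = t • ξ := by simp [hc]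
    rw [(hΞd (c t) hq _).2]
    have hr := hradd (c t) hq (e, -f (c t) e - p (c t) • e)
    have hr0 := hrad (c t) hq
    rw [hfst] at hr hr0
    rw [show ((t • ξ, -f (c t) (t • ξ) - p (c t) • t • ξ) : E × E)
      = t • (ξ, -f (c t) ξ - p (c t) • ξ) by
        simp [smul_sub, smul_comm t (p (c t))]] at hr hr0
    rw [map_smul, smul_eq_mul] at hr hr0
    rw [hHsym _ hq] at hr
    have hsplit : ∀ a : E, ((a, -f (c t) a - p (c t) • a) : E × E)
        = (a, -f (c t) a) - p (c t) • (0, a) := fun a ↦ by simp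
    -- This is the integrability of the full system: flatness handles the horizontal parts, symmetry
    -- the parts multiplied by `p`.
    have hS : fderiv ℝ f (c t) (ξ, -f (c t) ξ - p (c t) • ξ) e
        = fderiv ℝ f (c t) (e, -f (c t) e - p (c t) • e) ξ := by
      rw [hsplit, hsplit, map_sub, map_sub, map_smul, map_smul]
      simp only [sub_apply, smul_apply]
      rw [hsym _ hq ξ e, hcurv _ hq ξ e]
    dsimp only at hr
    rw [show ((e, -(fderiv ℝ f (c t) (e, -f (c t) e - p (c t) • e)) (t • ξ) - f (c t) e
        - fderiv ℝ p (c t) (e, -f (c t) e - p (c t) • e) • t • ξ - p (c t) • e) : E × E)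
      = (e, -f (c t) e - p (c t) • e)
        + t • (0, -fderiv ℝ f (c t) (e, -f (c t) e - p (c t) • e) ξ)
        - (t * fderiv ℝ p (c t) (e, -f (c t) e - p (c t) • e)) • (0, ξ) by
          ext
          · simp
          · simp only [map_smul, Prod.snd_sub, Prod.snd_add, Prod.smul_snd, smul_smul, smul_neg,
              mul_comm t]
            abel] at hr
    rw [map_sub, map_add, map_smul, map_smul, smul_eq_mul, smul_eq_mul] at hr
    rw [hS, show ((0, -fderiv ℝ f (c t) (e, -f (c t) e - p (c t) • e) ξ
        - fderiv ℝ p (c t) (ξ, -f (c t) ξ - p (c t) • ξ) • e) : E × E)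
      = (0, -fderiv ℝ f (c t) (e, -f (c t) e - p (c t) • e) ξ)
        - fderiv ℝ p (c t) (ξ, -f (c t) ξ - p (c t) • ξ) • (0, e) by simp,
      map_sub, map_smul, smul_eq_mul]
    simp only [hΞ, id, Function.comp_apply]
    linear_combination hr - (fderiv ℝ p (c t) (0, e)) * hr0
  -- Grönwall: `t Ξ` solves a homogeneous linear ODE with bounded coefficient and zero initial
  -- value.
  have hz := eq_zero_of_abs_deriv_le_mul_abs_self_of_eq_zero_right (K := K)
    (f := fun t ↦ t * Ξ (c t)) (f' := fun t ↦ fderiv ℝ p (c t) (0, ξ) * (t * Ξ (c t)))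
    (a := 0) (b := 1) (fun t ht ↦ (hg t ht).continuousWithinAt)
    (fun t ht ↦ ((hg t (Ico_subset_Icc_self ht)).mono_of_mem_nhdsWithin
      (Icc_mem_nhdsGE_of_mem ht))) (by simp)
    (fun t ht ↦ by
      rw [norm_mul]
      exact mul_le_mul_of_nonneg_right (hK t (Ico_subset_Icc_self ht)) (norm_nonneg _))
    1 (right_mem_Icc.2 zero_le_one)
  simpa [hΞ, hc] using hz

end RadialUniqueness

/-! ### Vanishing Riemann curvature forces a flat nonlinear connection. -/

section Curvature

variable {E : Type u} [NormedAddCommGroup E] [NormedSpace ℝ E]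

/-- The nonlinear connection `N e = D_y G e` of a spray with coefficient vector `G`. -/
noncomputable def sprayConnection (G : E × E → E) (q : E × E) : E →L[ℝ] E :=
  (fderiv ℝ G q).comp (ContinuousLinearMap.inr ℝ E E)

@[simp] theorem sprayConnection_apply (G : E × E → E) (q : E × E) (e : E) :
    sprayConnection G q e = fderiv ℝ G q (0, e) := rfl

theorem ContDiffOn.sprayConnection {G : E × E → E} {W : Set (E × E)} (hW : IsOpen W)
    (hG : ContDiffOn ℝ ∞ G W) : ContDiffOn ℝ ∞ (sprayConnection G) W :=
  (hG.fderiv_of_isOpen hW (by simp)).clm_comp contDiffOn_const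

theorem ContDiffOn.hasFDerivAt_of_isOpen {F : Type*} [NormedAddCommGroup F] [NormedSpace ℝ F]
    {G : E → F} {W : Set E} (hW : IsOpen W) (hG : ContDiffOn ℝ ∞ G W) {q : E} (hq : q ∈ W) :
    HasFDerivAt G (fderiv ℝ G q) q :=
  ((hG.contDiffAt (hW.mem_nhds hq)).differentiableAt (by simp)).hasFDerivAt

theorem ContDiffOn.fderiv_fderiv_symm {F : Type*} [NormedAddCommGroup F] [NormedSpace ℝ F]
    {G : E → F} {W : Set E} (hW : IsOpen W) (hG : ContDiffOn ℝ ∞ G W) {q : E} (hq : q ∈ W)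
    (v w : E) : fderiv ℝ (fderiv ℝ G) q v w = fderiv ℝ (fderiv ℝ G) q w v :=
  ((hG.contDiffAt (hW.mem_nhds hq)).isSymmSndFDerivAt
    (by simpa using WithTop.coe_le_coe.2 (le_top : (2 : ℕ∞) ≤ ⊤))) v w

theorem fderiv_sprayConnection {G : E × E → E} {W : Set (E × E)} (hW : IsOpen W)
    (hG : ContDiffOn ℝ ∞ G W) {q : E × E} (hq : q ∈ W) (v : E × E) (e : E) :
    fderiv ℝ (sprayConnection G) q v e = fderiv ℝ (fderiv ℝ G) q v (0, e) := by
  have h := ((hG.fderiv_of_isOpen (m := ∞) hW (by simp)).hasFDerivAt_of_isOpen hW hq).clm_comp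
    (hasFDerivAt_const (ContinuousLinearMap.inr ℝ E E) q)
  have h' : HasFDerivAt (sprayConnection G) _ q := h
  rw [h'.fderiv]
  simp

/-- The Riemann curvature of a spray with coefficient vector `G`, applied to `e`. -/
noncomputable def riemannVec (G : E × E → E) (q : E × E) (e : E) : E :=
  (2 : ℝ) • fderiv ℝ G q (e, 0) - fderiv ℝ (fderiv ℝ G) q (q.2, 0) (0, e)
    + (2 : ℝ) • fderiv ℝ (fderiv ℝ G) q (0, G q) (0, e) - fderiv ℝ G q (0, fderiv ℝ G q (0, e))

/-- If the Riemann curvature of a spray vanishes, then so does the curvature of its nonlinear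
connection. -/
theorem sprayConnection_flat {G : E × E → E} {W : Set (E × E)} (hW : IsOpen W)
    (hG : ContDiffOn ℝ ∞ G W) (hR : ∀ q ∈ W, ∀ e, riemannVec G q e = 0)
    {q : E × E} (hq : q ∈ W) (e ξ : E) :
    fderiv ℝ (sprayConnection G) q (e, -sprayConnection G q e) ξ
      = fderiv ℝ (sprayConnection G) q (ξ, -sprayConnection G q ξ) e := by
  have hD : ContDiffOn ℝ ∞ (fderiv ℝ G) W := hG.fderiv_of_isOpen hW (by simp)
  have hH : ContDiffOn ℝ ∞ (fderiv ℝ (fderiv ℝ G)) W := hD.fderiv_of_isOpen hW (by simp)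
  set D := fderiv ℝ G with hDdef
  set H := fderiv ℝ D with hHdef
  set T := fderiv ℝ H with hTdef
  have hG1 := hG.hasFDerivAt_of_isOpen hW hq
  have hD1 := hD.hasFDerivAt_of_isOpen hW hq
  have hH1 := hH.hasFDerivAt_of_isOpen hW hq
  have hHs : ∀ r ∈ W, ∀ v w, H r v w = H r w v := fun r hr v w ↦ hG.fderiv_fderiv_symm hW hr v w
  have hT12 : ∀ a b c, T q a b c = T q b a c := fun a b c ↦ by
    rw [hTdef, hHdef, hD.fderiv_fderiv_symm hW hq]
  have hT23 : ∀ a b c, T q a b c = T q a c b := by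
    intro a b c
    have h1 : HasFDerivAt (fun r ↦ H r b c) _ q :=
      (hH1.clm_apply (hasFDerivAt_const b q)).clm_apply (hasFDerivAt_const c q)
    have h2 : HasFDerivAt (fun r ↦ H r c b) _ q :=
      (hH1.clm_apply (hasFDerivAt_const c q)).clm_apply (hasFDerivAt_const b q)
    have h3 := h2.congr_of_eventuallyEq (f₁ := fun r ↦ H r b c)
      (by filter_upwards [hW.mem_nhds hq] with r hr using hHs r hr b c)
    simpa [← hTdef] using congrArg (fun l : E × E →L[ℝ] E ↦ l a) (h1.unique h3)
  have hT13 : ∀ a b c, T q a b c = T q c b a := fun a b c ↦ by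
    rw [hT12, hT23, hT12]
  -- The vertical derivative of `riemannVec G · e = 0` in the direction `ξ`.
  have key : ∀ e ξ : E, (2 : ℝ) • H q (0, ξ) (e, 0)
      - (T q (0, ξ) (q.2, 0) (0, e) + H q (ξ, 0) (0, e))
      + (2 : ℝ) • (T q (0, ξ) (0, G q) (0, e) + H q (0, D q (0, ξ)) (0, e))
      - (H q (0, ξ) (0, D q (0, e)) + D q (0, H q (0, ξ) (0, e))) = 0 := by
    intro e ξ
    have c0 : ∀ v : E × E, HasFDerivAt (fun _ : E × E ↦ v) (0 : E × E →L[ℝ] E × E) q :=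
      fun v ↦ hasFDerivAt_const v q
    have z0 : HasFDerivAt (fun _ : E × E ↦ (0 : E)) (0 : E × E →L[ℝ] E) q := hasFDerivAt_const _ q
    have h1 := (hD1.clm_apply (c0 (e, 0))).const_smul (2 : ℝ)
    have h2 := (hH1.clm_apply ((hasFDerivAt_snd (𝕜 := ℝ) (E := E) (F := E) (p := q)).prodMk
      z0)).clm_apply (c0 (0, e))
    have h3 := ((hH1.clm_apply (z0.prodMk hG1)).clm_apply (c0 (0, e))).const_smul (2 : ℝ)
    have h4 := hD1.clm_apply (z0.prodMk (hD1.clm_apply (c0 (0, e))))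
    have h5 : HasFDerivAt (fun r ↦ riemannVec G r e) _ q := ((h1.sub h2).add h3).sub h4
    have h6 : HasFDerivAt (fun r ↦ riemannVec G r e) (0 : E × E →L[ℝ] E) q :=
      (hasFDerivAt_const (𝕜 := ℝ) (0 : E) q).congr_of_eventuallyEq
        (by filter_upwards [hW.mem_nhds hq] with r hr using hR r hr e)
    have := congrArg (fun l : E × E →L[ℝ] E ↦ l (0, ξ)) (h5.unique h6)
    simp only [add_apply, ContinuousLinearMap.comp_apply, ContinuousLinearMap.prod_apply,
      ContinuousLinearMap.flip_apply, ContinuousLinearMap.coe_snd', sub_apply, zero_apply,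
      smul_apply, map_zero, zero_add] at this
    refine Eq.trans ?_ this
    rw [add_comm (H q (ξ, 0) (0, e)), add_comm (H q (0, fderiv ℝ G q (0, ξ)) (0, e)),
      add_comm (D q (0, fderiv ℝ D q (0, ξ) (0, e)))]
  rw [fderiv_sprayConnection hW hG hq, fderiv_sprayConnection hW hG hq]
  have hsplit : ∀ a b : E, ((a, -b) : E × E) = (a, 0) - (0, b) := fun a b ↦ by simp
  simp only [sprayConnection_apply, ← hDdef, ← hHdef, hsplit, map_sub, sub_apply]
  have k1 := key e ξ
  have k2 := key ξ e
  rw [hHs q hq (0, ξ) (e, 0), hHs q hq (0, ξ) (0, D q (0, e))] at k1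
  rw [hHs q hq (0, e) (ξ, 0), hHs q hq (0, e) (0, D q (0, ξ)), hHs q hq (0, e) (0, ξ),
    hT13 (0, e), hT13 (0, e)] at k2
  -- Antisymmetrising in `e` and `ξ` cancels the third derivatives and the term `D (0, H (0, ξ) (0,
  -- e))`; the rest is three times the curvature.
  linear_combination (norm := module) (1 / 3 : ℝ) • k1 - (1 / 3 : ℝ) • k2

end Curvature

/-! ### Index notation translated into Fréchet derivatives. -/

section Coordinates

open SprayGeometry

variable {n : ℕ}

/-- The coefficient functions of a spray, assembled to a vector. -/
noncomputable def coeffVec (G : Fin n → Coord n × Coord n → ℝ) (p : Coord n × Coord n) : Coord n :=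
  WithLp.toLp 2 (fun i ↦ G i p)

theorem fderiv_coeffVec_apply {G : Fin n → Coord n × Coord n → ℝ} {p : Coord n × Coord n}
    (hG : DifferentiableAt ℝ (coeffVec G) p) (i : Fin n) (v : Coord n × Coord n) :
    fderiv ℝ (G i) p v = fderiv ℝ (coeffVec G) p v i := by
  have h : HasFDerivAt (G i) _ p :=
    (EuclideanSpace.proj (𝕜 := ℝ) i).hasFDerivAt.comp p hG.hasFDerivAt
  rw [h.fderiv]
  rfl

theorem Coord.sum_smul_single (y : Coord n) :
    ∑ j, y j • EuclideanSpace.single j (1 : ℝ) = y := by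
  ext i
  simp [Finset.sum_apply, Pi.single_apply]

theorem sum_mul_map_single {F : Type*} [AddCommGroup F] [Module ℝ F] (l : Coord n →ₗ[ℝ] F)
    (y : Coord n) : ∑ j, y j • l (EuclideanSpace.single j (1 : ℝ)) = l y := by
  conv_rhs => rw [← Coord.sum_smul_single y]
  simp

theorem riemannCoeff_eq {G : Fin n → Coord n × Coord n → ℝ} {W : Set (Coord n × Coord n)}
    (hW : IsOpen W) (hG : ContDiffOn ℝ ∞ (coeffVec G) W) {p : Coord n × Coord n} (hp : p ∈ W)
    (i k : Fin n) :
    riemannCoeff G i k p = riemannVec (coeffVec G) p (EuclideanSpace.single k 1) i := by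
  have h1 : ∀ q ∈ W, ∀ i v, fderiv ℝ (G i) q v = fderiv ℝ (coeffVec G) q v i := fun q hq i v ↦
    fderiv_coeffVec_apply (hG.hasFDerivAt_of_isOpen hW hq).differentiableAt i v
  have h2 : ∀ v w, fderiv ℝ (fun q ↦ fderiv ℝ (G i) q w) p v
      = fderiv ℝ (fderiv ℝ (coeffVec G)) p v w i := by
    intro v w
    have hd := ((hG.fderiv_of_isOpen (m := ∞) hW (by simp)).hasFDerivAt_of_isOpen hW hp).clm_apply
      (hasFDerivAt_const w p)
    have hd' := ((EuclideanSpace.proj (𝕜 := ℝ) i).hasFDerivAt.comp p hd).congr_of_eventuallyEq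
      (f₁ := fun q ↦ fderiv ℝ (G i) q w)
      (by filter_upwards [hW.mem_nhds hp] with q hq using h1 q hq i w)
    rw [hd'.fderiv]
    simp
  have hy : ∑ j, p.2 j * fderiv ℝ (fderiv ℝ (coeffVec G)) p (EuclideanSpace.single j 1, 0)
        (0, EuclideanSpace.single k 1) i
      = fderiv ℝ (fderiv ℝ (coeffVec G)) p (p.2, 0) (0, EuclideanSpace.single k 1) i :=
    sum_mul_map_single ((EuclideanSpace.proj (𝕜 := ℝ) i).comp
      (((fderiv ℝ (fderiv ℝ (coeffVec G)) p).comp (.inl ℝ _ _)).flip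
        (0, EuclideanSpace.single k 1))).toLinearMap p.2
  have hGj : ∑ j, G j p * fderiv ℝ (fderiv ℝ (coeffVec G)) p (0, EuclideanSpace.single j 1)
        (0, EuclideanSpace.single k 1) i
      = fderiv ℝ (fderiv ℝ (coeffVec G)) p (0, coeffVec G p) (0, EuclideanSpace.single k 1) i :=
    sum_mul_map_single ((EuclideanSpace.proj (𝕜 := ℝ) i).comp
      (((fderiv ℝ (fderiv ℝ (coeffVec G)) p).comp (.inr ℝ _ _)).flip
        (0, EuclideanSpace.single k 1))).toLinearMap (coeffVec G p)
  have hN : ∑ j, fderiv ℝ (coeffVec G) p (0, EuclideanSpace.single j 1) i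
        * fderiv ℝ (coeffVec G) p (0, EuclideanSpace.single k 1) j
      = fderiv ℝ (coeffVec G) p (0, fderiv ℝ (coeffVec G) p (0, EuclideanSpace.single k 1)) i := by
    simp_rw [mul_comm (fderiv ℝ (coeffVec G) p (0, EuclideanSpace.single _ 1) i)]
    exact sum_mul_map_single ((EuclideanSpace.proj (𝕜 := ℝ) i).comp
      ((fderiv ℝ (coeffVec G) p).comp (.inr ℝ _ _))).toLinearMap _
  simp only [riemannCoeff, pdx, pdy, riemannVec]
  erw [Finset.sum_congr rfl fun j _ ↦ congrArg (p.2 j * ·) (h2 _ _),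
    Finset.sum_congr rfl fun j _ ↦ congrArg (G j p * ·) (h2 _ _), hy, hGj,
    Finset.sum_congr rfl fun j _ ↦ congrArg₂ (· * ·) (h1 p hp i _) (h1 p hp j _), hN, h1 p hp]
  simp

/-- The curvature is linear in `e`, so the basis vectors suffice. -/
theorem riemannVec_eq_zero {G : Fin n → Coord n × Coord n → ℝ} {W : Set (Coord n × Coord n)}
    (hW : IsOpen W) (hG : ContDiffOn ℝ ∞ (coeffVec G) W)
    (hR : ∀ p ∈ W, ∀ i k, riemannCoeff G i k p = 0) {p : Coord n × Coord n} (hp : p ∈ W)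
    (e : Coord n) : riemannVec (coeffVec G) p e = 0 := by
  have hk : ∀ k, riemannVec (coeffVec G) p (EuclideanSpace.single k 1) = 0 := fun k ↦ by
    ext i
    rw [← riemannCoeff_eq hW hG hp, hR p hp]
    rfl
  let D := fderiv ℝ (coeffVec G) p
  let H := fderiv ℝ (fderiv ℝ (coeffVec G)) p
  let l : Coord n →L[ℝ] Coord n := (2 : ℝ) • D.comp (.inl ℝ _ _)
    - (H (p.2, 0)).comp (.inr ℝ _ _) + (2 : ℝ) • (H (0, coeffVec G p)).comp (.inr ℝ _ _)
    - (D.comp (.inr ℝ _ _)).comp (D.comp (.inr ℝ _ _))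
  have hl : ∀ e, riemannVec (coeffVec G) p e = l e := fun e ↦ rfl
  rw [hl, ← ContinuousLinearMap.coe_coe, ← sum_mul_map_single]
  exact Finset.sum_eq_zero fun j _ ↦ by
    rw [ContinuousLinearMap.coe_coe, ← hl, hk, smul_zero]

theorem horizontalDeriv_eq {G : Fin n → Coord n × Coord n → ℝ} {p : Coord n × Coord n}
    (hG : DifferentiableAt ℝ (coeffVec G) p) (k : Fin n) (f : Coord n × Coord n → ℝ) :
    horizontalDeriv G k f p = fderiv ℝ f p
      (EuclideanSpace.single k 1, -sprayConnection (coeffVec G) p (EuclideanSpace.single k 1)) := by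
  simp only [horizontalDeriv, pdx, pdy, fderiv_coeffVec_apply hG]
  rw [show ((EuclideanSpace.single k 1,
      -sprayConnection (coeffVec G) p (EuclideanSpace.single k 1)) : Coord n × Coord n)
    = (EuclideanSpace.single k 1, 0)
      - (0, fderiv ℝ (coeffVec G) p (0, EuclideanSpace.single k 1)) by simp, map_sub]
  congr 1
  exact sum_mul_map_single ((fderiv ℝ f p).comp (.inr ℝ _ _)).toLinearMap _

end Coordinates

/-! ### Solving the Funk equation with values prescribed over the centre. -/

section RadialFunk

variable {E : Type u} [NormedAddCommGroup E] [NormedSpace ℝ E] [CompleteSpace E]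

/-- Solutions of `dp(e, -f e - p e) = 0` with prescribed values `φ` over the centre `x₀`, for a
compactly supported connection `f` that is symmetric and flat on part of the space. -/
theorem exists_radialFunk {f : E × E → E →L[ℝ] E} {φ : E → ℝ} (hf : ContDiff ℝ ∞ f)
    (hfc : HasCompactSupport f) (hφ : ContDiff ℝ ∞ φ) (hφc : HasCompactSupport φ) (x₀ : E)
    {ε : ℝ} (hε : 0 < ε) :
    ∃ δ > 0, δ ≤ ε ∧ ∃ p : E × E → ℝ, ∃ η : E × E → E,
      ContDiffOn ℝ ∞ p (Metric.ball x₀ δ ×ˢ univ) ∧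
      (∀ x ∈ Metric.ball x₀ δ, ∀ y, p (x, y) = φ (η (x, y)) ∧ ‖η (x, y) - y‖ ≤ ε) ∧
      (∀ y, η (x₀, y) = y) ∧
      (∀ x ∈ Metric.ball x₀ δ, ∀ y,
        (∀ q ∈ Metric.ball x₀ δ ×ˢ Metric.ball y (2 * ε), ∀ e ξ,
          fderiv ℝ f q (0, e) ξ = fderiv ℝ f q (0, ξ) e ∧
          fderiv ℝ f q (e, -f q e) ξ = fderiv ℝ f q (ξ, -f q ξ) e) →
        ∀ e, fderiv ℝ p (x, y) (e, -f (x, y) e - p (x, y) • e) = 0) ∧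
      (∀ x ∈ Metric.ball x₀ δ, ∀ y, ∀ c : ℝ,
        (∀ z ∈ Metric.ball x₀ δ, ∀ w ∈ Metric.closedBall y ε, f (z, c • w) = c • f (z, w)) →
        (∀ w ∈ Metric.closedBall y ε, φ (c • w) = c * φ w) → p (x, c • y) = c * p (x, y)) := by
  -- The third argument receives `u 0`, so `φ q.2.2` is the constant value of the solution along the
  -- characteristic.
  let A : E × E × E → E →L[ℝ] E := fun q ↦
    f (q.1, q.2.1) + φ q.2.2 • ContinuousLinearMap.id ℝ E
  have hA : ContDiff ℝ ∞ A :=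
    (hf.comp (contDiff_fst.prodMk contDiff_snd.fst)).add
      ((hφ.comp contDiff_snd.snd).smul contDiff_const)
  obtain ⟨C₁, hC₁⟩ := hfc.exists_bound_of_continuous hf.continuous
  obtain ⟨C₂, hC₂⟩ := hφc.exists_bound_of_continuous hφ.continuous
  obtain ⟨L₁, hL₁⟩ := hf.lipschitzWith_of_hasCompactSupport hfc (by simp)
  obtain ⟨L₂, hL₂⟩ := hφ.lipschitzWith_of_hasCompactSupport hφc (by simp)
  have hC : ∀ q, ‖A q‖ ≤ C₁ + C₂ * ‖ContinuousLinearMap.id ℝ E‖ := fun q ↦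
    (norm_add_le _ _).trans (add_le_add (hC₁ _) (by
      rw [norm_smul]
      exact mul_le_mul_of_nonneg_right (hC₂ _) (norm_nonneg _)))
  obtain ⟨L, hL⟩ : ∃ L, LipschitzWith L A := by
    have h1 : LipschitzWith 1 (fun q : E × E × E ↦ (q.1, q.2.1)) := by
      refine LipschitzWith.of_dist_le_mul fun a b ↦ ?_
      simp only [Prod.dist_eq, NNReal.coe_one, one_mul]
      exact max_le_max le_rfl (le_max_left _ _)
    have h2 : LipschitzWith 1 (fun q : E × E × E ↦ q.2.2) := by
      refine LipschitzWith.of_dist_le_mul fun a b ↦ ?_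
      simp only [Prod.dist_eq, NNReal.coe_one, one_mul]
      exact (le_max_right _ _).trans (le_max_right _ _)
    exact ⟨_, (hL₁.comp h1).add ((ContinuousLinearMap.lipschitz
      ((ContinuousLinearMap.id ℝ ℝ).smulRight (ContinuousLinearMap.id ℝ E))).comp (hL₂.comp h2))⟩
  obtain ⟨δ, hδ, hδε, u, hu, huniq, hue⟩ := exists_radialTransport hA hC hL x₀ hε
  have htr : ∀ x ∈ Metric.ball x₀ δ, ∀ y, IsRadialTransport A x₀ x y (u (x, y)) := fun x hx y ↦
    (huniq x hx y _).2 rfl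
  have hxt : ∀ x ∈ Metric.ball x₀ δ, ∀ t ∈ Icc (0 : ℝ) 1,
      x₀ + t • (x - x₀) ∈ Metric.ball x₀ δ := by
    intro x hx t ht
    exact (convex_ball x₀ δ).add_smul_sub_mem (Metric.mem_ball_self hδ) hx ht
  let p : E × E → ℝ := fun q ↦ φ (u q 0)
  have hp : ContDiffOn ℝ ∞ p (Metric.ball x₀ δ ×ˢ univ) :=
    hφ.comp_contDiffOn ((ContinuousMap.evalCLM (M := E) ℝ (0 : unitInterval)).contDiff.comp_contDiffOn hu)
  have hopen : IsOpen (Metric.ball x₀ δ ×ˢ (univ : Set E)) := Metric.isOpen_ball.prod isOpen_univ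
  -- A rescaled initial piece of the characteristic is, by uniqueness, the characteristic through
  -- the intermediate point, and both start at the same `u 0`.
  have hconst : ∀ x ∈ Metric.ball x₀ δ, ∀ y, ∀ t ∈ Icc (0 : ℝ) 1,
      p (x₀ + t • (x - x₀), pathAt (u (x, y)) t) = p (x, y) := by
    intro x hx y t ht
    have h := (htr x hx y).restrict hA.continuous ⟨t, ht⟩
    have h' := (huniq _ (hxt x hx t ht) _ _).1 h
    simp only [p]
    rw [show pathAt (u (x, y)) t = u (x, y) ⟨t, ht⟩ from pathAt_coe _ ⟨t, ht⟩, ← h']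
    simp
  have hder : ∀ x ∈ Metric.ball x₀ δ, ∀ y, ∀ t ∈ Icc (0 : ℝ) 1,
      HasDerivWithinAt (pathAt (u (x, y)))
        (-f (x₀ + t • (x - x₀), pathAt (u (x, y)) t) (x - x₀)
          - p (x₀ + t • (x - x₀), pathAt (u (x, y)) t) • (x - x₀)) (Icc 0 1) t := by
    intro x hx y t ht
    refine ((htr x hx y).hasDerivWithinAt hA.continuous ht).congr_deriv ?_
    rw [hconst x hx y t ht]
    have : pathAt (u (x, y)) 0 = u (x, y) 0 := pathAt_coe _ 0
    simp only [A, p, add_apply, smul_apply, ContinuousLinearMap.id_apply, this]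
    abel
  have hone : ∀ x ∈ Metric.ball x₀ δ, ∀ y, pathAt (u (x, y)) 1 = y := fun x hx y ↦
    (pathAt_coe _ 1).trans (htr x hx y).apply_one
  -- Differentiating the constancy along the characteristic at its end point `t = 1`.
  have hrad : ∀ x ∈ Metric.ball x₀ δ, ∀ y, fderiv ℝ p (x, y)
      (x - x₀, -f (x, y) (x - x₀) - p (x, y) • (x - x₀)) = 0 := by
    intro x hx y
    have h1 : HasDerivWithinAt (fun t : ℝ ↦ x₀ + t • (x - x₀)) (x - x₀) (Icc 0 1) 1 := by
      simpa using (((hasDerivAt_id (1 : ℝ)).smul_const (x - x₀)).const_add x₀).hasDerivWithinAt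
    have h2 := hder x hx y 1 (right_mem_Icc.2 zero_le_one)
    have h3 := h1.prodMk h2
    have e1 : x₀ + (1 : ℝ) • (x - x₀) = x := by simp
    rw [hone x hx y, e1] at h3
    have h4 : HasFDerivAt p (fderiv ℝ p (x, y))
        (x₀ + (1 : ℝ) • (x - x₀), pathAt (u (x, y)) 1) := by
      rw [e1, hone x hx y]
      exact hp.hasFDerivAt_of_isOpen hopen ⟨hx, mem_univ _⟩
    have h5 := h4.comp_hasDerivWithinAt (1 : ℝ) h3
    have h6 : HasDerivWithinAt (fun _ : ℝ ↦ p (x, y)) 0 (Icc 0 1) 1 := hasDerivWithinAt_const _ _ _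
    have h7 := h5.congr_of_mem (f₁ := fun _ : ℝ ↦ p (x, y))
      (fun t ht ↦ (hconst x hx y t ht).symm) (right_mem_Icc.2 zero_le_one)
    exact (uniqueDiffOn_Icc_zero_one 1 (right_mem_Icc.2 zero_le_one)).eq_deriv _ h7 h6
  refine ⟨δ, hδ, hδε, p, fun q ↦ u q 0, hp, fun x hx y ↦ ⟨rfl, hue x hx y 0⟩, ?_, ?_, ?_⟩
  · intro y
    simpa using htr x₀ (Metric.mem_ball_self hδ) y 0
  · intro x hx y hflat e
    have := horizontal_eq_zero_of_radial (p := p) (f := f)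
      (W := Metric.ball x₀ δ ×ˢ Metric.ball y (2 * ε)) (Metric.isOpen_ball.prod Metric.isOpen_ball)
      (hp.mono (prod_mono_right (subset_univ _))) hf.contDiffOn
      (fun q hq e ξ ↦ (hflat q hq e ξ).1) (fun q hq e ξ ↦ (hflat q hq e ξ).2)
      (x₀ := x₀) (ξ := x - x₀) (fun q hq ↦ hrad q.1 hq.1 q.2) (u := pathAt (u (x, y)))
      (fun t ht ↦ ⟨hxt x hx t ht, by
        rw [Metric.mem_ball, dist_eq_norm]
        have := hue x hx y ⟨t, ht⟩
        rw [← pathAt_coe] at this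
        exact this.trans_lt (by linarith)⟩)
      (fun t ht ↦ hder x hx y t ht) e
    rwa [hone x hx y, add_sub_cancel] at this
  · intro x hx y c hfc hφc
    have hmem : ∀ s, pathAt (u (x, y)) s ∈ Metric.closedBall y ε := fun s ↦ by
      rw [Metric.mem_closedBall, dist_eq_norm]
      exact hue x hx y _
    -- The path stays within `ε` of `y`, where `f` and `φ` scale by `c`; hence `c • u` solves the
    -- equation with end value `c • y`.
    have hc : IsRadialTransport A x₀ x (c • y) (c • u (x, y)) := by
      intro t
      rw [ContinuousMap.smul_apply, htr x hx y t, smul_add, ← intervalIntegral.integral_smul]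
      congr 1
      refine intervalIntegral.integral_congr fun s hs ↦ ?_
      rw [uIcc_of_le t.2.2] at hs
      have hs' : s ∈ Icc (0 : ℝ) 1 := ⟨t.2.1.trans hs.1, hs.2⟩
      have e1 : ∀ s, pathAt (c • u (x, y)) s = c • pathAt (u (x, y)) s := fun s ↦ rfl
      simp only [A, e1, hfc _ (hxt x hx s hs') _ (hmem s), hφc _ (hmem 0), add_apply, smul_apply,
        ContinuousLinearMap.id_apply, smul_add, smul_smul]
    have := (huniq x hx _ _).1 hc
    simp only [p]
    rw [← this, ContinuousMap.smul_apply]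
    exact hφc _ (by simpa [pathAt] using hmem 0)

end RadialFunk

/-! ### Homogeneous solutions on a cone. -/

section ConicFunk

theorem contDiff_of_tsupport {V F : Type*} [NormedAddCommGroup V] [NormedSpace ℝ V]
    [NormedAddCommGroup F] [NormedSpace ℝ F] {f : V → F}
    (hf : ∀ v ∈ tsupport f, ContDiffAt ℝ ∞ f v) : ContDiff ℝ ∞ f := by
  rw [contDiff_iff_contDiffAt]
  intro v
  by_cases hv : v ∈ tsupport f
  · exact hf v hv
  · exact contDiffAt_const.congr_of_eventuallyEq (notMem_tsupport_iff_eventuallyEq.1 hv)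

variable {E : Type u} [NormedAddCommGroup E] [InnerProductSpace ℝ E]

/-- The connection coefficients of a positively 2-homogeneous spray are positively
1-homogeneous. -/
theorem sprayConnection_smul {G : E × E → E} {C : Set (E × E)} (hC : IsOpen C)
    (hG : ContDiffOn ℝ ∞ G C) {c : ℝ} (hc : c ≠ 0)
    (hhom : ∀ q ∈ C, G (q.1, c • q.2) = c ^ 2 • G q) {q : E × E} (hq : q ∈ C)
    (hq' : (q.1, c • q.2) ∈ C) :
    sprayConnection G (q.1, c • q.2) = c • sprayConnection G q := by
  ext1 e
  have h1 : HasFDerivAt (fun r : E × E ↦ ((r.1, c • r.2) : E × E))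
      ((ContinuousLinearMap.fst ℝ E E).prod (c • ContinuousLinearMap.snd ℝ E E)) q :=
    hasFDerivAt_fst.prodMk (hasFDerivAt_snd.const_smul c)
  have h2 := (hG.hasFDerivAt_of_isOpen hC hq').comp q h1
  have h3 := ((hG.hasFDerivAt_of_isOpen hC hq).const_smul (c ^ 2)).congr_of_eventuallyEq
    (f₁ := G ∘ fun r : E × E ↦ ((r.1, c • r.2) : E × E))
    (by filter_upwards [hC.mem_nhds hq] with r hr using hhom r hr)
  have h4 := congrArg (fun l : E × E →L[ℝ] E ↦ l (0, e)) (h2.unique h3)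
  have h5 : c • fderiv ℝ G (q.1, c • q.2) (0, e) = c • c • fderiv ℝ G q (0, e) := by
    rw [← map_smul, smul_smul, ← sq]
    simpa using h4
  -- The chain rule scales the vertical vector by `c`, which cancels one factor of `c ^ 2`.
  exact smul_right_injective E hc h5

variable [FiniteDimensional ℝ E]

/-- A smooth function with compact support which is positively homogeneous near `y₀`, equals `1`
at `y₀` and vanishes outside a thin cone about `y₀`. -/
theorem exists_conic_bump {y₀ : E} {ℓ : E →L[ℝ] ℝ} (hℓ : ℓ y₀ = 1) {r ρ : ℝ} (hr : 0 < r)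
    (hρ : 0 < ρ) (hpos : ∀ y ∈ Metric.closedBall y₀ (2 * r), 0 < ℓ y) :
    ∃ φ : E → ℝ, ContDiff ℝ ∞ φ ∧ HasCompactSupport φ ∧ φ y₀ = 1 ∧
      (∀ c : ℝ, 0 < c → ∀ y ∈ Metric.closedBall y₀ r, c • y ∈ Metric.closedBall y₀ r →
        φ (c • y) = c * φ y) ∧
      ∀ y, φ y ≠ 0 → ‖(ℓ y)⁻¹ • y - y₀‖ ≤ ρ := by
  let χ : ContDiffBump y₀ := ⟨r, 2 * r, hr, by linarith⟩
  let β : ContDiffBump y₀ := ⟨ρ / 2, ρ, by positivity, by linarith⟩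
  -- `ℓ y * β (y / ℓ y)` is 1-homogeneous on `ℓ > 0` and lives in a thin cone; `χ` cuts it off
  -- inside a ball where `ℓ > 0`, away from the singularity of `y / ℓ y`.
  let φ : E → ℝ := fun y ↦ χ y * (ℓ y * β ((ℓ y)⁻¹ • y))
  have hsub : tsupport φ ⊆ Metric.closedBall y₀ (2 * r) := by
    refine (closure_mono ?_).trans (χ.tsupport_eq).le
    exact Function.support_mul_subset_left _ _
  refine ⟨φ, ?_, ?_, ?_, ?_, ?_⟩
  · refine contDiff_of_tsupport fun y hy ↦ ?_
    have h0 : ℓ y ≠ 0 := (hpos y (hsub hy)).ne'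
    exact χ.contDiffAt.mul (ℓ.contDiff.contDiffAt.mul (β.contDiff.contDiffAt.comp y
      ((ℓ.contDiff.contDiffAt.inv h0).smul contDiffAt_id)))
  · exact HasCompactSupport.of_support_subset_isCompact (isCompact_closedBall y₀ (2 * r))
      (subset_closure.trans hsub)
  · simp only [φ, hℓ, inv_one, one_smul, one_mul]
    rw [χ.one_of_mem_closedBall (Metric.mem_closedBall_self hr.le),
      β.one_of_mem_closedBall (Metric.mem_closedBall_self (by positivity)), one_mul]
  · intro c hc y hy hcy
    simp only [φ]
    rw [χ.one_of_mem_closedBall hy, χ.one_of_mem_closedBall hcy, one_mul, one_mul, map_smul,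
      smul_eq_mul, mul_inv, smul_smul, mul_right_comm c⁻¹, inv_mul_cancel₀ hc.ne', one_mul,
      mul_assoc]
  · intro y hy
    have : β ((ℓ y)⁻¹ • y) ≠ 0 := fun h ↦ hy (by simp [φ, h])
    have h := β.tsupport_eq.le (subset_closure this)
    rwa [Metric.mem_closedBall, dist_eq_norm] at h

/-- A smooth compactly supported extension of a map given on a neighbourhood of a ball. -/
theorem ContDiffOn.exists_compact_extension {V F : Type*} [NormedAddCommGroup V]
    [NormedSpace ℝ V] [FiniteDimensional ℝ V] [NormedAddCommGroup F] [NormedSpace ℝ F]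
    {g : V → F} {C : Set V} (hC : IsOpen C)
    (hg : ContDiffOn ℝ ∞ g C) {q : V} {r : ℝ} (hr : 0 < r)
    (hsub : Metric.closedBall q (2 * r) ⊆ C) :
    ∃ f : V → F, ContDiff ℝ ∞ f ∧ HasCompactSupport f ∧ EqOn f g (Metric.closedBall q r) := by
  let χ : ContDiffBump q := ⟨r, 2 * r, hr, by linarith⟩
  have hs : tsupport (fun v ↦ χ v • g v) ⊆ Metric.closedBall q (2 * r) :=
    (closure_mono (Function.support_smul_subset_left _ _)).trans χ.tsupport_eq.le
  refine ⟨fun v ↦ χ v • g v, ?_, ?_, ?_⟩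
  · exact contDiff_of_tsupport fun v hv ↦
      χ.contDiffAt.smul (hg.contDiffAt (hC.mem_nhds (hsub (hs hv))))
  · exact HasCompactSupport.of_support_subset_isCompact (isCompact_closedBall q (2 * r))
      (subset_closure.trans hs)
  · intro v hv
    simp only
    rw [χ.one_of_mem_closedBall hv, one_smul]

/-- Funk functions with prescribed value at one point, in coordinates. -/
theorem exists_funk_coordinates {G : E × E → E} {C : Set (E × E)} (hC : IsOpen C)
    (hne : ∀ q ∈ C, q.2 ≠ 0)
    (hG : ContDiffOn ℝ ∞ G C) (hhom : ∀ c : ℝ, 0 < c → ∀ q ∈ C, G (q.1, c • q.2) = c ^ 2 • G q)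
    (hR : ∀ q ∈ C, ∀ e, riemannVec G q e = 0) {x₀ y₀ : E} (h₀ : (x₀, y₀) ∈ C) :
    ∃ δ > 0, ∃ P : E × E → ℝ,
      ContDiffOn ℝ ∞ P (Metric.ball x₀ δ ×ˢ {0}ᶜ) ∧
      (∀ c : ℝ, 0 < c → ∀ q : E × E, P (q.1, c • q.2) = c * P q) ∧
      (∀ q ∈ C, q.1 ∈ Metric.ball x₀ δ → ∀ e,
        fderiv ℝ P q (e, -sprayConnection G q e) = P q * fderiv ℝ P q (0, e)) ∧
      P (x₀, y₀) ≠ 0 := by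
  have hy₀ : y₀ ≠ 0 := hne _ h₀
  have hy₀' : 0 < ‖y₀‖ := norm_pos_iff.2 hy₀
  let ℓ : E →L[ℝ] ℝ := (‖y₀‖ ^ 2)⁻¹ • innerSL ℝ y₀
  have hℓ₀ : ℓ y₀ = 1 := by
    simp only [ℓ, smul_apply, innerSL_apply_apply, real_inner_self_eq_norm_sq, smul_eq_mul]
    field_simp
  have hℓn : ∀ y, |ℓ y| ≤ ‖y‖ / ‖y₀‖ := by
    intro y
    simp only [ℓ, smul_apply, innerSL_apply_apply, smul_eq_mul, abs_mul]
    rw [abs_of_pos (by positivity)]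
    calc (‖y₀‖ ^ 2)⁻¹ * |inner ℝ y₀ y| ≤ (‖y₀‖ ^ 2)⁻¹ * (‖y₀‖ * ‖y‖) := by
          gcongr
          exact abs_real_inner_le_norm _ _
      _ = ‖y‖ / ‖y₀‖ := by field_simp
  obtain ⟨r₀, hr₀, hr₀C⟩ := Metric.isOpen_iff.1 hC _ h₀
  -- `4 r ≤ r₀` puts the closed ball of radius `2 r` into `C`; `4 r ≤ ‖y₀‖` gives `ℓ ≥ 1/2` on the
  -- ball of that radius about `y₀`.
  obtain ⟨r, hr, hrC, hry⟩ : ∃ r > 0, 4 * r ≤ r₀ ∧ 4 * r ≤ ‖y₀‖ :=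
    ⟨min (r₀ / 4) (‖y₀‖ / 4), by positivity, by linarith [min_le_left (r₀ / 4) (‖y₀‖ / 4)],
      by linarith [min_le_right (r₀ / 4) (‖y₀‖ / 4)]⟩
  have hCsub : Metric.closedBall (x₀, y₀) (2 * r) ⊆ C :=
    (Metric.closedBall_subset_ball (by linarith)).trans hr₀C
  have hℓsub : ∀ y s, ‖y - y₀‖ ≤ s → |ℓ y - 1| ≤ s / ‖y₀‖ := by
    intro y s hs
    rw [← hℓ₀, ← map_sub]
    exact (hℓn _).trans (by gcongr)
  have hℓhalf : ∀ y ∈ Metric.closedBall y₀ (2 * r), 1 / 2 ≤ ℓ y := by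
    intro y hy
    rw [Metric.mem_closedBall, dist_eq_norm] at hy
    have h1 := hℓsub y _ hy
    have h2 : 2 * r / ‖y₀‖ ≤ 1 / 2 := by
      rw [div_le_iff₀ hy₀']
      linarith
    linarith [(abs_le.1 h1).1]
  have hN : ContDiffOn ℝ ∞ (sprayConnection G) C := ContDiffOn.sprayConnection hC hG
  obtain ⟨f, hf, hfc, hfN⟩ := hN.exists_compact_extension hC hr hCsub
  obtain ⟨φ, hφ, hφc, hφ1, hφhom, hφsupp⟩ := exists_conic_bump (ρ := r / 32) hℓ₀ hr (by positivity)
    (fun y hy ↦ by linarith [hℓhalf y hy])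
  obtain ⟨δ, hδ, hδr, p, η, hp, hpη, hη, hPDE, hscale⟩ := exists_radialFunk hf hfc hφ hφc x₀
    (ε := r / 32) (by positivity)
  have hopen : IsOpen (Metric.ball x₀ δ ×ˢ (univ : Set E)) := Metric.isOpen_ball.prod isOpen_univ
  have hball : Metric.ball x₀ δ ×ˢ Metric.ball y₀ r ⊆ Metric.closedBall (x₀, y₀) r := by
    rintro ⟨x, y⟩ ⟨hx, hy⟩
    rw [← closedBall_prod_same]
    exact ⟨Metric.ball_subset_closedBall (Metric.ball_subset_ball (by linarith) hx),
      Metric.ball_subset_closedBall hy⟩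
  have hballC : Metric.ball x₀ δ ×ˢ Metric.ball y₀ r ⊆ C :=
    hball.trans ((Metric.closedBall_subset_closedBall (by linarith)).trans hCsub)
  have hfN' : ∀ q ∈ Metric.ball x₀ δ ×ˢ Metric.ball y₀ r, f =ᶠ[𝓝 q] sprayConnection G :=
    fun q hq ↦ by
      filter_upwards [(Metric.isOpen_ball.prod Metric.isOpen_ball).mem_nhds hq] with z hz
      exact hfN (hball hz)
  have hloc : ∀ x ∈ Metric.ball x₀ δ, ∀ y ∈ Metric.ball y₀ (r / 2), ∀ e,
      fderiv ℝ p (x, y) (e, -sprayConnection G (x, y) e - p (x, y) • e) = 0 := by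
    intro x hx y hy e
    have hsub : Metric.ball y (2 * (r / 32)) ⊆ Metric.ball y₀ r :=
      Metric.ball_subset_ball' (by linarith [Metric.mem_ball.1 hy])
    have h := hPDE x hx y (fun q hq e ξ ↦ ?_) e
    · rwa [hfN (hball ⟨hx, Metric.ball_subset_ball (by linarith) hy⟩)] at h
    · have hq' : q ∈ Metric.ball x₀ δ ×ˢ Metric.ball y₀ r := ⟨hq.1, hsub hq.2⟩
      have hqC := hballC hq'
      rw [(hfN' q hq').fderiv_eq, hfN (hball hq')]
      refine ⟨?_, sprayConnection_flat hC hG hR hqC e ξ⟩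
      rw [fderiv_sprayConnection hC hG hqC, fderiv_sprayConnection hC hG hqC,
        hG.fderiv_fderiv_symm hC hqC]
  have hlochom : ∀ x ∈ Metric.ball x₀ δ, ∀ c : ℝ, 0 < c → ∀ y ∈ Metric.ball y₀ (r / 2),
      c • y ∈ Metric.ball y₀ (r / 2) → p (x, c • y) = c * p (x, y) := by
    intro x hx c hc y hy hcy
    have hy' := hy
    have hcy' := hcy
    rw [Metric.mem_ball, dist_eq_norm] at hy' hcy'
    -- Both `ℓ y` and `c * ℓ y` lie within 1/8 of 1. A bound on `c` is needed so that dilating the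
    -- `r / 32` ball about `y` stays in the ball of radius `r`.
    have hc2 : c ≤ 2 := by
      have h1 := (abs_le.1 (hℓsub _ _ hy'.le)).1
      have h2 := (abs_le.1 (hℓsub _ _ hcy'.le)).2
      have h3 : r / 2 / ‖y₀‖ ≤ 1 / 8 := by
        rw [div_le_iff₀ hy₀']
        linarith
      rw [map_smul, smul_eq_mul] at h2
      nlinarith
    have hw : ∀ w ∈ Metric.closedBall y (r / 32),
        w ∈ Metric.ball y₀ r ∧ c • w ∈ Metric.ball y₀ r := by
      intro w hw
      refine ⟨Metric.closedBall_subset_ball' (by linarith [Metric.mem_ball.1 hy]) hw, ?_⟩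
      rw [Metric.mem_closedBall, dist_eq_norm] at hw
      rw [Metric.mem_ball, dist_eq_norm]
      calc ‖c • w - y₀‖ = ‖c • (w - y) + (c • y - y₀)‖ := by rw [smul_sub]; congr 1; abel
        _ ≤ c * ‖w - y‖ + ‖c • y - y₀‖ := by
            refine (norm_add_le _ _).trans ?_
            rw [norm_smul, Real.norm_of_nonneg hc.le]
        _ ≤ 2 * (r / 32) + ‖c • y - y₀‖ := by gcongr
        _ < r := by linarith
    refine hscale x hx y c (fun z hz w hwy ↦ ?_) (fun w hwy ↦ ?_)
    · have h1 : (z, w) ∈ Metric.ball x₀ δ ×ˢ Metric.ball y₀ r := ⟨hz, (hw w hwy).1⟩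
      have h2 : (z, c • w) ∈ Metric.ball x₀ δ ×ˢ Metric.ball y₀ r := ⟨hz, (hw w hwy).2⟩
      rw [hfN (hball h1), hfN (hball h2)]
      exact sprayConnection_smul hC hG hc.ne' (hhom c hc) (hballC h1) (hballC h2)
    · exact hφhom c hc w (Metric.ball_subset_closedBall (hw w hwy).1)
        (Metric.ball_subset_closedBall (hw w hwy).2)
  -- A nonzero value forces the initial point `z` into the thin cone. Since `z` is within `r / 32`
  -- of `w` and `ℓ w = 1`, also `w` is close to `y₀`; the three errors are `r / 32`, `r / 16`, `r /
  -- 32`.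
  have hsupp : ∀ x ∈ Metric.ball x₀ δ, ∀ w ∈ Metric.ball y₀ (r / 2), ℓ w = 1 → p (x, w) ≠ 0 →
      ‖w - y₀‖ ≤ r / 4 := by
    intro x hx w hw hℓw hne
    obtain ⟨h1, h2⟩ := hpη x hx w
    rw [h1] at hne
    have h3 := hφsupp _ hne
    set z := η (x, w)
    have hz : z ∈ Metric.closedBall y₀ (2 * r) := by
      refine Metric.closedBall_subset_closedBall' (x := w) (ε₁ := r / 32)
        (by linarith [Metric.mem_ball.1 hw]) ?_
      rwa [Metric.mem_closedBall, dist_eq_norm]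
    have hℓz : ℓ z ≠ 0 := by linarith [hℓhalf z hz]
    have h4 : |ℓ z - 1| ≤ r / 32 / ‖y₀‖ := by
      rw [← hℓw, ← map_sub]
      exact (hℓn _).trans (by gcongr)
    set v := (ℓ z)⁻¹ • z with hv
    have h5 : ‖v‖ ≤ 2 * ‖y₀‖ := by
      have := norm_le_norm_add_norm_sub' v y₀
      linarith
    have h6 : ‖z - v‖ ≤ r / 16 := by
      rw [show z - v = (ℓ z - 1) • v by rw [sub_smul, hv, smul_smul, mul_inv_cancel₀ hℓz]; simp,
        norm_smul, Real.norm_eq_abs]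
      calc |ℓ z - 1| * ‖v‖ ≤ r / 32 / ‖y₀‖ * (2 * ‖y₀‖) := by gcongr
        _ = r / 16 := by field_simp; norm_num
    calc ‖w - y₀‖ = ‖-(z - w) + (z - v) + (v - y₀)‖ := by congr 1; abel
      _ ≤ ‖z - w‖ + ‖z - v‖ + ‖v - y₀‖ := by
          refine (norm_add₃_le).trans ?_
          rw [norm_neg]
      _ ≤ r / 4 := by linarith
  -- The cone over the disc of radius `r / 2` about `y₀` in the slice `ℓ = 1`. By `hsupp` the
  -- solution vanishes on the collar between radii `r / 4` and `r / 2`, so the extension by zero is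
  -- smooth.
  let O : Set E := {y | ‖y - ℓ y • y₀‖ < r / 2 * ℓ y}
  have hO : IsOpen O := isOpen_lt (by fun_prop) (by fun_prop)
  have hOpos : ∀ y ∈ O, 0 < ℓ y := fun y hy ↦ by
    have := (norm_nonneg _).trans_lt (show ‖y - ℓ y • y₀‖ < r / 2 * ℓ y from hy)
    exact pos_of_mul_pos_right this (by positivity)
  have hnorm : ∀ y, 0 < ℓ y → ‖(ℓ y)⁻¹ • y - y₀‖ = (ℓ y)⁻¹ * ‖y - ℓ y • y₀‖ := by
    intro y hy
    rw [← abs_of_pos (inv_pos.2 hy), ← Real.norm_eq_abs, ← norm_smul, smul_sub, smul_smul,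
      Real.norm_eq_abs, abs_of_pos (inv_pos.2 hy), inv_mul_cancel₀ hy.ne', one_smul]
  have hOball : ∀ y ∈ O, (ℓ y)⁻¹ • y ∈ Metric.ball y₀ (r / 2) := by
    intro y hy
    rw [Metric.mem_ball, dist_eq_norm, hnorm y (hOpos y hy), inv_mul_lt_iff₀ (hOpos y hy), mul_comm]
    exact hy
  have hOsmul : ∀ c : ℝ, 0 < c → ∀ y, c • y ∈ O ↔ y ∈ O := by
    intro c hc y
    simp only [O, mem_ofPred_eq, map_smul, smul_eq_mul]
    rw [mul_smul, ← smul_sub, norm_smul, Real.norm_of_nonneg hc.le, mul_left_comm,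
      mul_lt_mul_iff_right₀ hc]
  classical
  let P : E × E → ℝ := fun q ↦ if q.2 ∈ O then ℓ q.2 * p (q.1, (ℓ q.2)⁻¹ • q.2) else 0
  have hzero : ∀ x ∈ Metric.ball x₀ δ, ∀ y ≠ 0, y ∉ O → P =ᶠ[𝓝 (x, y)] fun _ ↦ 0 := by
    intro x hx y hy hyO
    have hmem : (x, y) ∈ Metric.ball x₀ δ ×ˢ {y | r / 4 * ℓ y < ‖y - ℓ y • y₀‖} := by
      -- If the strict inequality failed, `y ∉ O` would give `r / 2 * ℓ y ≤ r / 4 * ℓ y`, forcing `ℓ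
      -- y = 0` and then `y = 0`.
      refine ⟨hx, ?_⟩
      by_contra! h
      simp only [mem_ofPred_eq, not_lt] at h
      have h1 : r / 2 * ℓ y ≤ ‖y - ℓ y • y₀‖ := not_lt.1 hyO
      have h2 : ℓ y = 0 := by
        have := norm_nonneg (y - ℓ y • y₀)
        nlinarith
      rw [h2] at h
      simp only [zero_smul, sub_zero, mul_zero, norm_le_zero_iff] at h
      exact hy h
    filter_upwards [(Metric.isOpen_ball.prod (isOpen_lt (by fun_prop) (by fun_prop))).mem_nhds hmem]
      with z hz
    simp only [P]
    split_ifs with hzO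
    · have hpos := hOpos _ hzO
      by_contra hne
      have h1 := hsupp z.1 hz.1 _ (hOball _ hzO) (by simp [hpos.ne']) (right_ne_zero_of_mul hne)
      rw [hnorm _ hpos, inv_mul_le_iff₀ hpos, mul_comm] at h1
      exact absurd hz.2 (not_lt.2 h1)
    · rfl
  refine ⟨δ, hδ, P, ?_, ?_, ?_, ?_⟩
  · rintro ⟨x, y⟩ ⟨hx, hy⟩
    refine ContDiffAt.contDiffWithinAt ?_
    by_cases hyO : y ∈ O
    · have hnhds : Metric.ball x₀ δ ×ˢ O ∈ 𝓝 (x, y) :=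
        (Metric.isOpen_ball.prod hO).mem_nhds ⟨hx, hyO⟩
      have h1 : ContDiffAt ℝ ∞ (fun q : E × E ↦ ((q.1, (ℓ q.2)⁻¹ • q.2) : E × E)) (x, y) :=
        contDiffAt_fst.prodMk (((ℓ.contDiff.contDiffAt.comp (x, y) contDiffAt_snd).inv
          (hOpos y hyO).ne').smul contDiffAt_snd)
      have h2 : ContDiffAt ℝ ∞ p (x, (ℓ y)⁻¹ • y) :=
        hp.contDiffAt (hopen.mem_nhds ⟨hx, mem_univ _⟩)
      refine ((ℓ.contDiff.contDiffAt.comp (x, y) contDiffAt_snd).mul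
        (h2.comp (x, y) h1)).congr_of_eventuallyEq ?_
      filter_upwards [hnhds] with z hz
      simp only [P, if_pos hz.2]
      rfl
    · exact contDiffAt_const.congr_of_eventuallyEq (hzero x hx y hy hyO)
  · intro c hc q
    simp only [P, hOsmul c hc, map_smul, smul_eq_mul, mul_inv, smul_smul]
    rw [mul_right_comm c⁻¹, inv_mul_cancel₀ hc.ne', one_mul]
    split_ifs
    · ring
    · simp
  · rintro ⟨x, y⟩ hq hx e
    by_cases hyO : y ∈ O
    · set c := (ℓ y)⁻¹ with hc
      have hcpos : 0 < c := inv_pos.2 (hOpos y hyO)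
      have hcC : (x, c • y) ∈ C := hballC ⟨hx, Metric.ball_subset_ball (by linarith) (hOball y hyO)⟩
      have hcont : ContinuousAt (fun q : E × E ↦ c • q.2) (x, y) := by fun_prop
      -- Local homogeneity allows the scale `c` to be frozen near `(x, y)`, so no derivative of `ℓ`
      -- enters.
      have hev : P =ᶠ[𝓝 (x, y)] fun q ↦ c⁻¹ * p (q.1, c • q.2) := by
        filter_upwards [(Metric.isOpen_ball.prod hO).mem_nhds ⟨hx, hyO⟩,
          hcont.preimage_mem_nhds (Metric.isOpen_ball.mem_nhds (hOball y hyO))] with z hz hz'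
        have hpos := hOpos _ hz.2
        have h1 : (c * ℓ z.2) • ((ℓ z.2)⁻¹ • z.2) = c • z.2 := by
          rw [smul_smul, mul_inv_cancel_right₀ hpos.ne']
        have h2 := hlochom z.1 hz.1 (c * ℓ z.2) (by positivity) _ (hOball _ hz.2) (by
          rw [h1]
          exact hz')
        simp only [P, if_pos hz.2]
        rw [← h1, h2]
        field_simp
      have hd : HasFDerivAt (fun q : E × E ↦ ((q.1, c • q.2) : E × E))
          ((ContinuousLinearMap.fst ℝ E E).prod (c • ContinuousLinearMap.snd ℝ E E)) (x, y) :=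
        hasFDerivAt_fst.prodMk (hasFDerivAt_snd.const_smul c)
      have hd' := ((hp.hasFDerivAt_of_isOpen hopen
        (show (x, c • y) ∈ _ from ⟨hx, mem_univ _⟩)).comp (x, y) hd).const_mul c⁻¹
      have hdP : ∀ a b, fderiv ℝ P (x, y) (a, b) = c⁻¹ * fderiv ℝ p (x, c • y) (a, c • b) := by
        intro a b
        rw [(hd'.congr_of_eventuallyEq hev).fderiv]
        simp
      have hval : p (x, c • y) = c * P (x, y) := by
        rw [hev.eq_of_nhds, mul_inv_cancel_left₀ hcpos.ne']
      have hN := sprayConnection_smul hC hG hcpos.ne' (hhom c hcpos) hq hcC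
      have h := hloc x hx (c • y) (hOball y hyO) e
      dsimp only at hN
      rw [hval, hN, show ((e, -(c • sprayConnection G (x, y)) e - (c * P (x, y)) • e) : E × E)
        = (e, c • -sprayConnection G (x, y) e) - P (x, y) • (0, c • e) by
          ext <;> simp [mul_smul, smul_comm c (P (x, y))], map_sub, map_smul, smul_eq_mul] at h
      rw [hdP, hdP]
      linear_combination c⁻¹ * h
    · rw [(hzero x hx y (hne _ hq) hyO).fderiv_eq]
      simp
  · have hmem : y₀ ∈ O := by
      simp only [O, mem_ofPred_eq, hℓ₀, one_smul, sub_self, norm_zero]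
      linarith
    have h := (hpη x₀ (Metric.mem_ball_self hδ) y₀).1
    rw [hη, hφ1] at h
    simp [P, hmem, hℓ₀, h]

end ConicFunk

/-! ### Induced coordinates on the tangent bundle and their changes. -/

section InducedCoordinates

open SprayGeometry

variable {n : ℕ} {M : Type*} [TopologicalSpace M] {φ ψ : OpenPartialHomeomorph M (Coord n)}

theorem isOpen_coords_target : IsOpen {p : Coord n × Coord n | p.1 ∈ φ.target} :=
  φ.open_target.preimage continuous_fst

theorem isOpen_chart_change : IsOpen (φ.target ∩ φ.symm ⁻¹' ψ.source) :=
  φ.isOpen_inter_preimage_symm ψ.open_source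

variable [ChartedSpace (Coord n) M]

theorem mdifferentiable_of_mem_maximalAtlas (hφ : φ ∈ IsManifold.maximalAtlas (𝓡 n) ∞ M) :
    φ.MDifferentiable (𝓡 n) (𝓡 n) :=
  ⟨(contMDiffOn_of_mem_maximalAtlas hφ).mdifferentiableOn (by simp),
    (contMDiffOn_symm_of_mem_maximalAtlas hφ).mdifferentiableOn (by simp)⟩

theorem contDiffOn_chart_change (hφ : φ ∈ IsManifold.maximalAtlas (𝓡 n) ∞ M)
    (hψ : ψ ∈ IsManifold.maximalAtlas (𝓡 n) ∞ M) :
    ContDiffOn ℝ ∞ (ψ ∘ φ.symm) (φ.target ∩ φ.symm ⁻¹' ψ.source) := by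
  rw [← contMDiffOn_iff_contDiffOn]
  exact (contMDiffOn_of_mem_maximalAtlas hψ).comp
    ((contMDiffOn_symm_of_mem_maximalAtlas hφ).mono inter_subset_left) fun x hx ↦ hx.2

/-- The change of coordinates on `TM` induced by a change of charts. -/
noncomputable def transition (φ ψ : OpenPartialHomeomorph M (Coord n)) (p : Coord n × Coord n) :
    Coord n × Coord n :=
  (ψ (φ.symm p.1), fderiv ℝ (ψ ∘ φ.symm) p.1 p.2)

/-- The second derivative of the chart change enters because the fibre map depends on the base
point; it is the source of the inhomogeneous term in the law for the connection. -/
theorem hasFDerivAt_transition (hφ : φ ∈ IsManifold.maximalAtlas (𝓡 n) ∞ M)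
    (hψ : ψ ∈ IsManifold.maximalAtlas (𝓡 n) ∞ M) {p : Coord n × Coord n}
    (hp : p.1 ∈ φ.target ∩ φ.symm ⁻¹' ψ.source) :
    HasFDerivAt (transition φ ψ) (fderiv ℝ (transition φ ψ) p) p ∧ ∀ a b,
      fderiv ℝ (transition φ ψ) p (a, b) = (fderiv ℝ (ψ ∘ φ.symm) p.1 a,
        fderiv ℝ (fderiv ℝ (ψ ∘ φ.symm)) p.1 a p.2 + fderiv ℝ (ψ ∘ φ.symm) p.1 b) := by
  have h1 := contDiffOn_chart_change hφ hψ
  have h2 := h1.hasFDerivAt_of_isOpen isOpen_chart_change hp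
  have h3 := (h1.fderiv_of_isOpen (m := ∞) isOpen_chart_change
    (by simp)).hasFDerivAt_of_isOpen isOpen_chart_change hp
  have h4 : HasFDerivAt (transition φ ψ) _ p := (h2.comp p hasFDerivAt_fst).prodMk
    ((h3.comp p hasFDerivAt_fst).clm_apply hasFDerivAt_snd)
  refine ⟨h4.differentiableAt.hasFDerivAt, fun a b ↦ ?_⟩
  rw [h4.fderiv]
  simp [add_comm]

variable [IsManifold (𝓡 n) ∞ M]

theorem isOpen_proj_preimage {s : Set M} (hs : IsOpen s) : IsOpen {v : TM n M | v.proj ∈ s} :=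
  hs.preimage (FiberBundle.continuous_proj (Coord n) (TangentSpace (𝓡 n) (M := M)))

theorem coords_ofCoords (hφ : φ ∈ IsManifold.maximalAtlas (𝓡 n) ∞ M) {p : Coord n × Coord n}
    (hp : p.1 ∈ φ.target) : coords φ (ofCoords φ p) = p := by
  have h := (mdifferentiable_of_mem_maximalAtlas hφ).comp_symm_deriv hp
  have h2 := congrArg (fun l : Coord n →L[ℝ] Coord n ↦ l p.2) h
  exact Prod.ext (φ.right_inv hp) h2

theorem ofCoords_coords (hφ : φ ∈ IsManifold.maximalAtlas (𝓡 n) ∞ M) {v : TM n M}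
    (hv : v.proj ∈ φ.source) : ofCoords φ (coords φ v) = v := by
  obtain ⟨x, y⟩ := v
  have h := (mdifferentiable_of_mem_maximalAtlas hφ).symm_comp_deriv hv
  have h2 : mfderiv (𝓡 n) (𝓡 n) φ.symm (φ x) (mfderiv (𝓡 n) (𝓡 n) φ x y) = y :=
    congrArg (fun l : Coord n →L[ℝ] Coord n ↦ l y) h
  have h1 : φ.symm (φ x) = x := φ.left_inv hv
  simp only [ofCoords, coords]
  refine Bundle.TotalSpace.ext h1 ?_
  exact heq_of_eq h2

theorem coords_dilate (c : ℝ) (v : TM n M) :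
    coords φ (dilate c v) = ((coords φ v).1, c • (coords φ v).2) := by
  exact Prod.ext rfl (map_smul (mfderiv (𝓡 n) (𝓡 n) φ v.proj) c v.snd)

/-- These coordinates are the tangent map of the chart followed by the trivialisation of the tangent
bundle of the model space; on the open source, within-derivatives are derivatives. -/
theorem contMDiffOn_coords (hφ : φ ∈ IsManifold.maximalAtlas (𝓡 n) ∞ M) :
    ContMDiffOn (𝓡 n).tangent 𝓘(ℝ, Coord n × Coord n) ∞ (coords φ)
      {v : TM n M | v.proj ∈ φ.source} := by
  have h := contMDiffOn_of_mem_maximalAtlas hφ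
  have h1 := h.comp (Bundle.contMDiff_proj (TangentSpace (𝓡 n) (M := M))).contMDiffOn
    (s := {v : TM n M | v.proj ∈ φ.source}) (fun v hv ↦ hv)
  have h2 := h.contMDiffOn_tangentMapWithin (m := ∞) (by simp) φ.open_source.uniqueMDiffOn
  have h3 := (contMDiff_snd_tangentBundle_modelSpace (n := ∞) (Coord n) (𝓡 n)).comp_contMDiffOn h2
  refine (h1.prodMk_space h3).congr fun v hv ↦ ?_
  have e := mfderivWithin_of_isOpen (I := 𝓡 n) (I' := 𝓡 n) (f := φ) φ.open_source hv
  exact Prod.ext rfl (congrArg (fun l : Coord n →L[ℝ] Coord n ↦ l v.snd) e).symm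

theorem contMDiff_mk_modelSpace (E : Type*) [NormedAddCommGroup E] [NormedSpace ℝ E] :
    ContMDiff 𝓘(ℝ, E × E) 𝓘(ℝ, E).tangent ∞
      (fun p : E × E ↦ (⟨p.1, p.2⟩ : TangentBundle 𝓘(ℝ, E) E)) := by
  intro p
  rw [Bundle.contMDiffAt_totalSpace]
  refine ⟨contDiff_fst.contMDiff.contMDiffAt, ?_⟩
  simpa using contDiff_snd.contMDiff.contMDiffAt

theorem contMDiffOn_ofCoords (hφ : φ ∈ IsManifold.maximalAtlas (𝓡 n) ∞ M) :
    ContMDiffOn 𝓘(ℝ, Coord n × Coord n) (𝓡 n).tangent ∞ (ofCoords φ : _ → TM n M)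
      {p | p.1 ∈ φ.target} := by
  have h := contMDiffOn_symm_of_mem_maximalAtlas hφ
  have h2 := h.contMDiffOn_tangentMapWithin (m := ∞) (by simp) φ.open_target.uniqueMDiffOn
  refine (h2.comp (contMDiff_mk_modelSpace (Coord n)).contMDiffOn
    (s := {p : Coord n × Coord n | p.1 ∈ φ.target}) (fun p hp ↦ hp)).congr fun p hp ↦ ?_
  have e := mfderivWithin_of_isOpen (I := 𝓡 n) (I' := 𝓡 n) (f := φ.symm) φ.open_target hp
  exact congrArg (Bundle.TotalSpace.mk (φ.symm p.1))
    (congrArg (fun l : Coord n →L[ℝ] Coord n ↦ l p.2) e).symm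

theorem isOpen_coords_source : IsOpen {v : TM n M | v.proj ∈ φ.source} :=
  isOpen_proj_preimage φ.open_source

theorem isOpen_ofCoords_preimage (hφ : φ ∈ IsManifold.maximalAtlas (𝓡 n) ∞ M)
    {s : Set (TM n M)} (hs : IsOpen s) : IsOpen {p | p.1 ∈ φ.target ∧ ofCoords φ p ∈ s} :=
  (contMDiffOn_ofCoords hφ).continuousOn.isOpen_inter_preimage isOpen_coords_target hs

/-- The components of a smooth vector field are smooth. -/
theorem contMDiffOn_components (hφ : φ ∈ IsManifold.maximalAtlas (𝓡 n) ∞ M)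
    {X : (v : TM n M) → TangentSpace (𝓡 n).tangent v} {s : Set (TM n M)}
    (hX : ContMDiffOn (𝓡 n).tangent (𝓡 n).tangent.tangent ∞
      (fun v ↦ (⟨v, X v⟩ : TangentBundle (𝓡 n).tangent (TM n M))) s) :
    ContMDiffOn (𝓡 n).tangent 𝓘(ℝ, Coord n × Coord n) ∞ (fun v ↦ components φ v (X v))
      (s ∩ {v | v.proj ∈ φ.source}) := by
  have h2 := (contMDiffOn_coords hφ).contMDiffOn_tangentMapWithin (m := ∞) (by simp)
    isOpen_coords_source.uniqueMDiffOn
  have h3 := (contMDiff_snd_tangentBundle_modelSpace (n := ∞) (Coord n × Coord n)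
    𝓘(ℝ, Coord n × Coord n)).comp_contMDiffOn h2
  refine (h3.comp (hX.mono inter_subset_left) (fun v hv ↦ hv.2)).congr fun v hv ↦ ?_
  have e := mfderivWithin_of_isOpen (I := (𝓡 n).tangent) (I' := 𝓘(ℝ, Coord n × Coord n))
    (f := coords φ) isOpen_coords_source hv.2
  exact (congrArg (fun l : Coord n × Coord n →L[ℝ] Coord n × Coord n ↦ l (X v)) e).symm

/-- The representation of a vector field on `TM` in induced coordinates. -/
theorem contDiffOn_components_ofCoords (hφ : φ ∈ IsManifold.maximalAtlas (𝓡 n) ∞ M)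
    {X : (v : TM n M) → TangentSpace (𝓡 n).tangent v} {s : Set (TM n M)}
    (hX : ContMDiffOn (𝓡 n).tangent (𝓡 n).tangent.tangent ∞
      (fun v ↦ (⟨v, X v⟩ : TangentBundle (𝓡 n).tangent (TM n M))) s) :
    ContDiffOn ℝ ∞ (fun p ↦ components φ (ofCoords φ p) (X (ofCoords φ p)))
      {p | p.1 ∈ φ.target ∧ ofCoords φ p ∈ s} := by
  rw [← contMDiffOn_iff_contDiffOn]
  exact (contMDiffOn_components hφ hX).comp ((contMDiffOn_ofCoords hφ).mono fun p hp ↦ hp.1)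
    fun p hp ↦ ⟨hp.2, φ.map_target hp.1⟩

theorem coords_ofCoords_eq_transition (hφ : φ ∈ IsManifold.maximalAtlas (𝓡 n) ∞ M)
    (hψ : ψ ∈ IsManifold.maximalAtlas (𝓡 n) ∞ M) {p : Coord n × Coord n}
    (hp : p.1 ∈ φ.target ∩ φ.symm ⁻¹' ψ.source) :
    coords ψ (ofCoords φ p) = transition φ ψ p := by
  refine Prod.ext rfl ?_
  have h := mfderiv_comp p.1 ((mdifferentiable_of_mem_maximalAtlas hψ).mdifferentiableAt hp.2)
    ((mdifferentiable_of_mem_maximalAtlas hφ).mdifferentiableAt_symm hp.1)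
  rw [mfderiv_eq_fderiv] at h
  exact (congrArg (fun l : Coord n →L[ℝ] Coord n ↦ l p.2) h).symm

theorem coords_eq_transition (hφ : φ ∈ IsManifold.maximalAtlas (𝓡 n) ∞ M)
    (hψ : ψ ∈ IsManifold.maximalAtlas (𝓡 n) ∞ M) {v : TM n M} (hv : v.proj ∈ φ.source)
    (hv' : v.proj ∈ ψ.source) : coords ψ v = transition φ ψ (coords φ v) := by
  rw [← coords_ofCoords_eq_transition hφ hψ, ofCoords_coords hφ hv]
  exact ⟨φ.map_source hv, by simpa [coords, φ.left_inv hv] using hv'⟩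

/-- The components of a tangent vector of `TM` transform by the derivative of the change of
coordinates. -/
theorem components_eq_fderiv_transition (hφ : φ ∈ IsManifold.maximalAtlas (𝓡 n) ∞ M)
    (hψ : ψ ∈ IsManifold.maximalAtlas (𝓡 n) ∞ M) {v : TM n M} (hv : v.proj ∈ φ.source)
    (hv' : v.proj ∈ ψ.source) (w : TangentSpace (𝓡 n).tangent v) :
    components ψ v w = fderiv ℝ (transition φ ψ) (coords φ v) (components φ v w) := by
  have hp : (coords φ v).1 ∈ φ.target ∩ φ.symm ⁻¹' ψ.source :=
    ⟨φ.map_source hv, by simpa [coords, φ.left_inv hv] using hv'⟩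
  have h1 : MDifferentiableAt (𝓡 n).tangent 𝓘(ℝ, Coord n × Coord n) (coords φ) v :=
    ((contMDiffOn_coords hφ).contMDiffAt (isOpen_coords_source.mem_nhds hv)).mdifferentiableAt
      (by simp)
  have h2 := (hasFDerivAt_transition hφ hψ hp).1.hasMFDerivAt
  have h3 : coords ψ =ᶠ[𝓝 v] transition φ ψ ∘ coords φ := by
    filter_upwards [isOpen_coords_source.mem_nhds hv, isOpen_coords_source.mem_nhds hv'] with u hu hu'
    exact coords_eq_transition hφ hψ hu hu'
  have h4 := (h2.comp v h1.hasMFDerivAt).congr_of_eventuallyEq h3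
  simp only [components]
  rw [h4.mfderiv]
  rfl

end InducedCoordinates

/-! ### Transformation laws of a spray and invariance of the Funk equation. -/

section SprayCoordinates

open SprayGeometry

variable {n : ℕ} {M : Type*} [TopologicalSpace M] [ChartedSpace (Coord n) M]
  [IsManifold (𝓡 n) ∞ M] {φ ψ : OpenPartialHomeomorph M (Coord n)}

/-- The domain of a spray in induced coordinates. -/
def coordDomain (G : Spray n M) (φ : OpenPartialHomeomorph M (Coord n)) :
    Set (Coord n × Coord n) :=
  {p | p.1 ∈ φ.target ∧ ofCoords φ p ∈ G.domain}

/-- The coefficient vector of a spray in induced coordinates. -/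
noncomputable def coordCoeff (G : Spray n M) (φ : OpenPartialHomeomorph M (Coord n)) :
    Coord n × Coord n → Coord n :=
  coeffVec (sprayCoeff G.field φ)

theorem isOpen_coordDomain (G : Spray n M) (hφ : φ ∈ IsManifold.maximalAtlas (𝓡 n) ∞ M) :
    IsOpen (coordDomain G φ) :=
  isOpen_ofCoords_preimage hφ G.isOpen_domain

theorem coords_mem_coordDomain (G : Spray n M) (hφ : φ ∈ IsManifold.maximalAtlas (𝓡 n) ∞ M)
    {v : TM n M} (hv : v ∈ G.domain) (hv' : v.proj ∈ φ.source) : coords φ v ∈ coordDomain G φ :=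
  ⟨φ.map_source hv', by rwa [ofCoords_coords hφ hv']⟩

theorem coordCoeff_eq (G : Spray n M) (p : Coord n × Coord n) :
    coordCoeff G φ p = (-(1 / 2) : ℝ) • (components φ (ofCoords φ p) (G.field (ofCoords φ p))).2 :=
  rfl

theorem contDiffOn_coordCoeff (G : Spray n M) (hφ : φ ∈ IsManifold.maximalAtlas (𝓡 n) ∞ M) :
    ContDiffOn ℝ ∞ (coordCoeff G φ) (coordDomain G φ) :=
  ((contDiffOn_components_ofCoords hφ G.smooth).snd).const_smul (-(1 / 2) : ℝ)

theorem snd_ne_zero_of_mem_coordDomain (G : Spray n M) {p : Coord n × Coord n}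
    (hp : p ∈ coordDomain G φ) : p.2 ≠ 0 := fun h ↦ by
  refine G.ne_zero _ hp.2 ?_
  have : mfderiv (𝓡 n) (𝓡 n) φ.symm p.1 p.2 = 0 := by
    rw [h]
    exact map_zero (mfderiv (𝓡 n) (𝓡 n) φ.symm p.1)
  exact this

theorem coordCoeff_smul (G : Spray n M) (hφ : φ ∈ IsManifold.maximalAtlas (𝓡 n) ∞ M) (c : ℝ)
    (hc : 0 < c) (p : Coord n × Coord n) (hp : p ∈ coordDomain G φ) :
    coordCoeff G φ (p.1, c • p.2) = c ^ 2 • coordCoeff G φ p := by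
  ext i
  have h := G.homogeneous φ hφ (ofCoords φ p) hp.2 (φ.map_target hp.1) c hc i
  rwa [coords_dilate, coords_ofCoords hφ hp.1] at h

theorem riemannVec_coordCoeff (G : Spray n M) (hG : G.IsRFlat)
    (hφ : φ ∈ IsManifold.maximalAtlas (𝓡 n) ∞ M) (p : Coord n × Coord n)
    (hp : p ∈ coordDomain G φ) (e : Coord n) : riemannVec (coordCoeff G φ) p e = 0 := by
  refine riemannVec_eq_zero (isOpen_coordDomain G hφ) (contDiffOn_coordCoeff G hφ)
    (fun q hq i k ↦ ?_) hp e
  have h := hG φ hφ (ofCoords φ q) hq.2 (φ.map_target hq.1) i k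
  rwa [coords_ofCoords hφ hq.1] at h

theorem components_field (G : Spray n M) (hφ : φ ∈ IsManifold.maximalAtlas (𝓡 n) ∞ M)
    {v : TM n M} (hv : v ∈ G.domain) (hv' : v.proj ∈ φ.source) :
    components φ v (G.field v) = ((coords φ v).2, (-2 : ℝ) • coordCoeff G φ (coords φ v)) := by
  refine Prod.ext (G.fst_components φ hφ v hv hv') ?_
  rw [coordCoeff_eq, ofCoords_coords hφ hv', smul_smul]
  norm_num

/-- The transformation rule of the coefficients of a spray. -/
theorem coordCoeff_transition (G : Spray n M) (hφ : φ ∈ IsManifold.maximalAtlas (𝓡 n) ∞ M)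
    (hψ : ψ ∈ IsManifold.maximalAtlas (𝓡 n) ∞ M) {p : Coord n × Coord n}
    (hp : p ∈ coordDomain G φ) (hp' : φ.symm p.1 ∈ ψ.source) :
    coordCoeff G ψ (transition φ ψ p) = fderiv ℝ (ψ ∘ φ.symm) p.1 (coordCoeff G φ p)
      - (1 / 2 : ℝ) • fderiv ℝ (fderiv ℝ (ψ ∘ φ.symm)) p.1 p.2 p.2 := by
  have hs : (ofCoords φ p : TM n M).proj ∈ φ.source := φ.map_target hp.1
  have h := components_eq_fderiv_transition hφ hψ hs hp' (G.field (ofCoords φ p))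
  rw [components_field G hφ hp.2 hs, components_field G hψ hp.2 hp', coords_ofCoords hφ hp.1,
    coords_ofCoords_eq_transition hφ hψ ⟨hp.1, hp'⟩,
    (hasFDerivAt_transition hφ hψ ⟨hp.1, hp'⟩).2] at h
  have h2 := (Prod.ext_iff.1 h).2
  simp only [map_smul] at h2
  linear_combination (norm := module) (-(1 / 2) : ℝ) • h2

/-- The transformation rule of the nonlinear connection of a spray. -/
theorem sprayConnection_transition (G : Spray n M) (hφ : φ ∈ IsManifold.maximalAtlas (𝓡 n) ∞ M)
    (hψ : ψ ∈ IsManifold.maximalAtlas (𝓡 n) ∞ M) {p : Coord n × Coord n}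
    (hp : p ∈ coordDomain G φ) (hp' : φ.symm p.1 ∈ ψ.source) (e : Coord n) :
    sprayConnection (coordCoeff G ψ) (transition φ ψ p) (fderiv ℝ (ψ ∘ φ.symm) p.1 e)
      = fderiv ℝ (ψ ∘ φ.symm) p.1 (sprayConnection (coordCoeff G φ) p e)
        - fderiv ℝ (fderiv ℝ (ψ ∘ φ.symm)) p.1 e p.2 := by
  set A := fderiv ℝ (ψ ∘ φ.symm) p.1
  set B := fderiv ℝ (fderiv ℝ (ψ ∘ φ.symm)) p.1
  have hB : ∀ a b, B a b = B b a := (contDiffOn_chart_change hφ hψ).fderiv_fderiv_symm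
    isOpen_chart_change ⟨hp.1, hp'⟩
  have hs : (ofCoords φ p : TM n M).proj ∈ φ.source := φ.map_target hp.1
  have hTp : transition φ ψ p ∈ coordDomain G ψ := by
    rw [← coords_ofCoords_eq_transition hφ hψ ⟨hp.1, hp'⟩]
    exact coords_mem_coordDomain G hψ hp.2 hp'
  -- Only the fibre variable is differentiated, with the base point fixed, in the transformation law
  -- of the coefficients. The quadratic term gives `B e y` by symmetry of `B`.
  have h1 := ((contDiffOn_coordCoeff G hψ).hasFDerivAt_of_isOpen (isOpen_coordDomain G hψ)
    hTp).comp p.2 ((hasFDerivAt_const (ψ (φ.symm p.1)) p.2).prodMk A.hasFDerivAt)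
  have h2 := (A.hasFDerivAt.comp p.2 (((contDiffOn_coordCoeff G hφ).hasFDerivAt_of_isOpen
    (isOpen_coordDomain G hφ) hp).comp p.2 (hasFDerivAt_prodMk_right p.1 p.2))).sub
    ((B.hasFDerivAt.clm_apply (hasFDerivAt_id p.2)).const_smul (1 / 2 : ℝ))
  have hmem : ∀ᶠ y in 𝓝 p.2, (p.1, y) ∈ coordDomain G φ :=
    (Continuous.prodMk_right p.1).continuousAt.eventually
      ((isOpen_coordDomain G hφ).mem_nhds hp)
  have h3 := h1.congr_of_eventuallyEq (f₁ := fun y ↦ A (coordCoeff G φ (p.1, y))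
      - (1 / 2 : ℝ) • B y y) (by
    filter_upwards [hmem] with y hy
    exact (coordCoeff_transition G hφ hψ hy hp').symm)
  have h4 := congrArg (fun l : Coord n →L[ℝ] Coord n ↦ l e) (h3.unique h2)
  simp only [ContinuousLinearMap.comp_apply, ContinuousLinearMap.prod_apply, sub_apply,
    smul_apply, add_apply, ContinuousLinearMap.flip_apply, ContinuousLinearMap.id_apply,
    zero_apply, ContinuousLinearMap.inr_apply, id] at h4
  rw [sprayConnection_apply, sprayConnection_apply]
  refine h4.trans ?_
  rw [hB p.2 e]
  module

/-- The Funk equation is invariant under changes of charts. -/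
theorem funk_of_funk_chart (G : Spray n M) (hφ : φ ∈ IsManifold.maximalAtlas (𝓡 n) ∞ M)
    (hψ : ψ ∈ IsManifold.maximalAtlas (𝓡 n) ∞ M) {v : TM n M} (hv : v ∈ G.domain)
    (hvφ : v.proj ∈ φ.source) (hvψ : v.proj ∈ ψ.source) {P : Coord n × Coord n → ℝ}
    (hP : DifferentiableAt ℝ P (coords φ v))
    (hfunk : ∀ e, fderiv ℝ P (coords φ v) (e, -sprayConnection (coordCoeff G φ) (coords φ v) e)
      = P (coords φ v) * fderiv ℝ P (coords φ v) (0, e)) (k : Fin n) :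
    horizontalDeriv (sprayCoeff G.field ψ) k ((P ∘ coords φ) ∘ ofCoords ψ) (coords ψ v)
      = P (coords φ v) * pdy k ((P ∘ coords φ) ∘ ofCoords ψ) (coords ψ v) := by
  have hp := coords_mem_coordDomain G hφ hv hvφ
  have hq := coords_mem_coordDomain G hψ hv hvψ
  have hp' : φ.symm (coords φ v).1 ∈ ψ.source := by simpa [coords, φ.left_inv hvφ] using hvψ
  have hq' : ψ.symm (coords ψ v).1 ∈ φ.source := by simpa [coords, ψ.left_inv hvψ] using hvφ
  have hqT := coords_eq_transition hφ hψ hvφ hvψ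
  have hpT := coords_eq_transition hψ hφ hvψ hvφ
  set p := coords φ v
  set q := coords ψ v
  set Q := (P ∘ coords φ) ∘ ofCoords ψ with hQ
  have hopen : ∀ {a b : OpenPartialHomeomorph M (Coord n)}, IsOpen
      {r : Coord n × Coord n | r.1 ∈ a.target ∩ a.symm ⁻¹' b.source} := fun {a b} ↦
    (isOpen_chart_change (φ := a) (ψ := b)).preimage continuous_fst
  have hQq : Q =ᶠ[𝓝 q] P ∘ transition ψ φ := by
    filter_upwards [hopen.mem_nhds (show q ∈ {r : Coord n × Coord n |
      r.1 ∈ ψ.target ∩ ψ.symm ⁻¹' φ.source} from ⟨hq.1, hq'⟩)] with r hr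
    exact congrArg P (coords_ofCoords_eq_transition hψ hφ hr)
  have hTψ := (hasFDerivAt_transition hψ hφ (p := q) ⟨hq.1, hq'⟩).1
  have hQd : DifferentiableAt ℝ Q q := by
    rw [hQq.differentiableAt_iff]
    refine DifferentiableAt.comp q ?_ hTψ.differentiableAt
    rwa [← hpT]
  obtain ⟨hT, hTab⟩ := hasFDerivAt_transition hφ hψ (p := p) ⟨hp.1, hp'⟩
  have hPQ : P =ᶠ[𝓝 p] Q ∘ transition φ ψ := by
    filter_upwards [hopen.mem_nhds (show p ∈ {r : Coord n × Coord n |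
      r.1 ∈ φ.target ∩ φ.symm ⁻¹' ψ.source} from ⟨hp.1, hp'⟩)] with r hr
    have h1 := coords_ofCoords_eq_transition hφ hψ hr
    simp only [hQ, Function.comp_apply]
    rw [← h1, ofCoords_coords hψ (v := (ofCoords φ r : TM n M)) hr.2, coords_ofCoords hφ hr.1]
  have hd : ∀ w, fderiv ℝ P p w = fderiv ℝ Q q (fderiv ℝ (transition φ ψ) p w) := by
    intro w
    have hQd' : HasFDerivAt Q (fderiv ℝ Q q) (transition φ ψ p) := by
      rw [← hqT]
      exact hQd.hasFDerivAt
    rw [((hQd'.comp p hT).congr_of_eventuallyEq hPQ).fderiv]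
    rfl
  -- The chart change has invertible derivative, so each basis vector of the new chart comes from
  -- some `e` in the old one.
  obtain ⟨e, he⟩ : ∃ e, fderiv ℝ (ψ ∘ φ.symm) p.1 e = EuclideanSpace.single k 1 := by
    have h1 := (contDiffOn_chart_change hφ hψ).hasFDerivAt_of_isOpen isOpen_chart_change
      (q := p.1) ⟨hp.1, hp'⟩
    have h2 := (contDiffOn_chart_change hψ hφ).hasFDerivAt_of_isOpen isOpen_chart_change
      (q := q.1) ⟨hq.1, hq'⟩
    have hpq : (φ ∘ ψ.symm) q.1 = p.1 := congrArg Prod.fst hpT.symm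
    rw [← hpq] at h1
    have h3 := (h1.comp q.1 h2).congr_of_eventuallyEq (f₁ := id) (by
      filter_upwards [isOpen_chart_change.mem_nhds (show q.1 ∈ ψ.target ∩ ψ.symm ⁻¹' φ.source
        from ⟨hq.1, hq'⟩)] with x hx
      simp [φ.left_inv hx.2, ψ.right_inv hx.1])
    refine ⟨fderiv ℝ (φ ∘ ψ.symm) q.1 (EuclideanSpace.single k 1), ?_⟩
    have h4 := congrArg (fun l : Coord n →L[ℝ] Coord n ↦ l (EuclideanSpace.single k 1))
      (h3.unique (hasFDerivAt_id q.1))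
    rw [← hpq]
    exact h4
  -- The inhomogeneous term of this law cancels the second derivative in `hTab`: the transition
  -- sends `(e, -N e)` to the horizontal lift of the image of `e`.
  have hN := sprayConnection_transition G hφ hψ hp hp' e
  rw [← hqT, he] at hN
  have hf := hfunk e
  rw [hd, hd, hTab, hTab, he, map_neg] at hf
  have hdiff : DifferentiableAt ℝ (coeffVec (sprayCoeff G.field ψ)) q :=
    ((contDiffOn_coordCoeff G hψ).hasFDerivAt_of_isOpen (isOpen_coordDomain G hψ)
      hq).differentiableAt
  rw [horizontalDeriv_eq hdiff, pdy]
  change fderiv ℝ Q q (_, -sprayConnection (coordCoeff G ψ) q _) = _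
  rw [hN, neg_sub, sub_eq_add_neg]
  simpa using hf

end SprayCoordinates

theorem theorem1p2 {n : ℕ} {M : Type*} [TopologicalSpace M]
    [ChartedSpace (SprayGeometry.Coord n) M] [IsManifold (𝓡 n) ∞ M]
    (G : SprayGeometry.Spray n M) (hG : G.IsRFlat)
    (v : SprayGeometry.TM n M) (hv : v ∈ G.domain) :
    ∃ U : Set M, IsOpen U ∧ v.proj ∈ U ∧
      ∃ P : SprayGeometry.TM n M → ℝ, G.IsFunkFunctionOn U P ∧ P v ≠ 0 := by
  let φ := chartAt (SprayGeometry.Coord n) v.proj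
  have hφ : φ ∈ IsManifold.maximalAtlas (𝓡 n) ∞ M := IsManifold.chart_mem_maximalAtlas v.proj
  have hvφ : v.proj ∈ φ.source := mem_chart_source _ _
  have hC := isOpen_coordDomain G hφ
  obtain ⟨δ, hδ, P, hP, hPhom, hPfunk, hP₀⟩ := exists_funk_coordinates hC
    (fun q hq ↦ snd_ne_zero_of_mem_coordDomain G hq) (contDiffOn_coordCoeff G hφ)
    (coordCoeff_smul G hφ) (riemannVec_coordCoeff G hG hφ)
    (x₀ := (SprayGeometry.coords φ v).1) (y₀ := (SprayGeometry.coords φ v).2)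
    (coords_mem_coordDomain G hφ hv hvφ)
  have hopen : IsOpen (Metric.ball (SprayGeometry.coords φ v).1 δ
      ×ˢ ({0}ᶜ : Set (SprayGeometry.Coord n))) :=
    Metric.isOpen_ball.prod isOpen_compl_singleton
  have hmem : ∀ w ∈ G.domain, w.proj ∈ φ.source ∩ φ ⁻¹' Metric.ball (SprayGeometry.coords φ v).1 δ →
      SprayGeometry.coords φ w ∈ Metric.ball (SprayGeometry.coords φ v).1 δ
        ×ˢ ({0}ᶜ : Set (SprayGeometry.Coord n)) := fun w hw hwU ↦
    ⟨hwU.2, snd_ne_zero_of_mem_coordDomain G (coords_mem_coordDomain G hφ hw hwU.1)⟩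
  refine ⟨φ.source ∩ φ ⁻¹' Metric.ball (SprayGeometry.coords φ v).1 δ,
    φ.isOpen_inter_preimage Metric.isOpen_ball, ⟨hvφ, Metric.mem_ball_self hδ⟩,
    P ∘ SprayGeometry.coords φ, ⟨?_, ?_, ?_⟩, hP₀⟩
  · exact hP.contMDiffOn.comp ((contMDiffOn_coords hφ).mono fun w hw ↦ hw.2.1)
      fun w hw ↦ hmem w hw.1 hw.2
  · intro w _ _ c hc
    simp only [Function.comp_apply, coords_dilate]
    exact hPhom c hc _
  · intro ψ hψ w hw hwU hwψ k
    exact funk_of_funk_chart G hφ hψ hw hwU.1 hwψ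
      (hP.hasFDerivAt_of_isOpen hopen (hmem w hw hwU)).differentiableAt
      (hPfunk _ (coords_mem_coordDomain G hφ hw hwU.1) hwU.2) k
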